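/- **Setting.** Order $\mathbb R^2$ coordinatewise. A ($2$-parameter) persistence module over a field $\mathbb F$ assigns to each $u\in\mathbb R^2$ a vector space $M_u$ and to each $u\preceq v$ a linear map $i_M(u,v):M_u\to M_v$, with $i_M(u,u)=\mathrm{id}$ and $i_M(v,w)\circ i_M(u,v)=i_M(u,w)$. Let $M,N$ be two such modules with all $M_u,N_u$ finite dimensional (for example, finitely presented modules), not both zero. *Lines.* A line $L$ of positive slope is always parametrized as $s\mapsto s\vec m+b$ with $m_1,m_2>0$, $\max(m_1,m_2)=1$, $b_1+b_2=0$; put $\hat m^L=\min(m_1,m_2)$. $M^L$ is the $1$-parameter module $s\mapsto M_{s\vec m+b}$; its persistence diagram $\mathrm{dgm}\,M^L$ is the multiset of the pairs $(\beta,d)$, $\beta<d\le\infty$, in a decomposition of $M^L$ as a finite direct sum of interval modules $I[\beta,d)$. The bottleneck distance $d_B\in[0,\infty]$ is the minimum, over all multi-bijections $\sigma$ between a sub-multiset of one diagram and a sub-multiset of the other, of the largest of the numbers $\|p-\sigma(p)\|_\infty$ for matched points $p$ and $(p_2-p_1)/2$ for unmatched points $p$ (with $\infty-\infty=0$, $\infty-a=\infty$).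 In the projective plane $\mathbb P^2=\mathbb R^2\cup\ell_\infty$, the point $u\in\mathbb R^2$ is $[1:u_1:u_2]$ (a proper point), and $L$ passes, besides its proper points, through the point $[0:m_1:m_2]$ at infinity. For $u\in\mathbb R^2$, let $p_L(u)=\max_i (u_i-b_i)/m_i$ be the parameter of the unique point of $L$ on the boundary of the cone $\{v: u\preceq v\}$. For a set $U\subseteq\mathbb P^2$, write $L\sim_U L'$ if each proper $u\in U$ lies on $L$, strictly to its left, or strictly to its right exactly when the same holds for $L'$, and for each $[0:v_1:v_2]\in U$ with $v_1,v_2>0$, the slope of $L$ is equal to, larger than, or smaller than $v_2/v_1$ exactly when the same holds for the slope of $L'$. *Property (P).* $C_M,C_N\subset\mathbb R^2$ are finite sets with closures $\overline C_M,\overline C_N$ under (coordinatewise) least upper bounds such that, for all $u\preceq v$, $\mathrm{rank}\,i_M(u,v)=\mathrm{rank}\,i_M(\bar u,\bar v)$, where $\bar u=\max\{c\in\overline C_M: c\preceq u\}$ and $\bar v=\max\{c\in\overline C_M: c\preceq v\}$, if $\{c\in\overline C_M: c\preceq u\}\neq\emptyset$, and $\mathrm{rank}\,i_M(u,v)=0$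 otherwise; likewise for $N$ and $C_N$. *Property (Q).* $\Omega\subset\mathbb P^2$ is a finite set such that, for all $u,v,w,x\in\overline C_M\cup\overline C_N$ and $\delta,\eta\in\{1,2\}$, the sign (positive, negative or zero) of $$\frac{|p_L(u)-p_L(v)|}{\delta}-\frac{|p_L(w)-p_L(x)|}{\eta}$$ is the same for any two lines of positive slope that are equivalent under $\sim_{\overline C_M\cup\overline C_N\cup\Omega}$. Let $\Omega_P=\Omega\cap\mathbb R^2$ and $\overline\Omega=\Omega\cup\{[0:1:1]\}$. **Statement.** For every vertical line $V$, the limit $$\mathrm{cost}(V):=\lim_{m_1\to0^+}\hat m^L\,d_B(\mathrm{dgm}\,M^L,\mathrm{dgm}\,N^L)\in[0,\infty],$$ taken over the lines $L$ of positive slope through a fixed point $r\in V$, exists and does not depend on $r$, and there is a line $L$ of positive slope that passes through a (proper) point of $\overline C_M\cup\overline C_N\cup\Omega_P$ and a different point of $\overline C_M\cup\overline C_N\cup\overline\Omega$, such that $$\mathrm{cost}(V)\le\hat m^L\,d_B(\mathrm{dgm}\,M^L,\mathrm{dgm}\,N^L).$$ The same holds for every horizontal line $V$, with the limit taken as $m_2\to0^+$.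 -/

import Mathlib

open Filter Topology
open scoped ENNReal LinearAlgebra.Projectivization

namespace MatchingDistance

universe u w w₁ w₂

/-! ## Persistence modules -/

/-- The parameter space `ℝ²`, with its coordinatewise partial order.  Coordinates are indexed by
`0` (horizontal) and `1` (vertical). -/
abbrev Plane : Type := Fin 2 → ℝ

/-- A persistence module over a field `F`, indexed by a preorder `P`. -/
structure PersistenceModule (F : Type u) [Field F] (P : Type) [Preorder P] where
  obj : P → Type w
  [addCommGroup : ∀ p, AddCommGroup (obj p)]
  [module : ∀ p, Module F (obj p)]
  map : ∀ {p q : P}, p ≤ q → (obj p →ₗ[F] obj q)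
  map_refl : ∀ p : P, map (le_refl p) = LinearMap.id
  map_trans : ∀ {p q r : P} (hpq : p ≤ q) (hqr : q ≤ r),
    map hqr ∘ₗ map hpq = map (hpq.trans hqr)

attribute [instance] PersistenceModule.addCommGroup PersistenceModule.module

namespace PersistenceModule

section General

variable {F : Type u} [Field F] {P : Type} [Preorder P]

/-- All the vector spaces of the module are finite dimensional (this holds for every finitely
presented module). -/
def PointwiseFinite (M : PersistenceModule.{u, w} F P) : Prop :=
  ∀ p, Module.Finite F (M.obj p)

/-- The zero module. -/
def IsTrivial (M : PersistenceModule.{u, w} F P) : Prop :=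
  ∀ p, Subsingleton (M.obj p)

/-- The rank of a transition map. -/
noncomputable def rank (M : PersistenceModule.{u, w} F P) {p q : P} (h : p ≤ q) : ℕ :=
  Module.finrank F (LinearMap.range (M.map h))

/-- Isomorphism of persistence modules. -/
def Isomorphic (M : PersistenceModule.{u, w₁} F P)
    (N : PersistenceModule.{u, w₂} F P) : Prop :=
  ∃ e : ∀ p, M.obj p ≃ₗ[F] N.obj p,
    ∀ (p q : P) (h : p ≤ q) (x : M.obj p), e q (M.map h x) = N.map h (e p x)

/-- The direct sum of a finite family of persistence modules. -/
def directSum {n : ℕ} (M : Fin n → PersistenceModule.{u, w} F P) :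
    PersistenceModule.{u, w} F P where
  obj p := ∀ j, (M j).obj p
  map h := LinearMap.pi fun j => (M j).map h ∘ₗ LinearMap.proj j
  map_refl p := by
    ext x j
    simp [(M _).map_refl]
  map_trans hpq hqr := by
    refine LinearMap.ext fun x => funext fun j => ?_
    simpa using LinearMap.congr_fun ((M j).map_trans hpq hqr) (x j)

end General

/-! ## Interval modules and persistence diagrams -/

/-- Membership of `s` in the half-open interval `[b, d)`, where `I = (b, d)`, `d ≤ ∞`. -/
def InInterval (I : ℝ × WithTop ℝ) (s : ℝ) : Prop :=
  I.1 ≤ s ∧ (s : WithTop ℝ) < I.2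

/-- The space of the interval module at `s`: all of `F` if `s ∈ [b, d)`, and `0` otherwise. -/
def intervalSpace (F : Type u) [Field F] (I : ℝ × WithTop ℝ) (s : ℝ) : Submodule F F where
  carrier := {x | ¬ InInterval I s → x = 0}
  add_mem' hx hy h := by simp [hx h, hy h]
  zero_mem' _ := rfl
  smul_mem' c x hx h := by simp [hx h]

open Classical in
/-- The interval module `I[b, d)`: the transition map from `s` to `t` is the identity if both `s`
and `t` lie in `[b, d)`, and zero otherwise. -/
noncomputable def interval (F : Type u) [Field F] (I : ℝ × WithTop ℝ) :
    PersistenceModule.{u, u} F ℝ where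
  obj s := intervalSpace F I s
  map {s t} _ :=
    LinearMap.codRestrict (intervalSpace F I t)
      (if InInterval I t then (intervalSpace F I s).subtype else 0)
      (fun x h => by simp [h])
  map_refl s := by
    refine LinearMap.ext fun x => Subtype.ext ?_
    by_cases h : InInterval I s
    · simp [h]
    · simpa [h] using (x.2 h).symm
  map_trans {p q r} hpq hqr := by
    refine LinearMap.ext fun x => Subtype.ext ?_
    by_cases hr : InInterval I r
    · by_cases hq : InInterval I q
      · simp [hr, hq]
      · have hp : ¬ InInterval I p := fun hp =>
          hq ⟨hp.1.trans hpq, lt_of_le_of_lt (WithTop.coe_le_coe.2 hqr) hr.2⟩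
        have hx : (x : F) = 0 := x.2 hp
        simp [hr, hq, hx]
    · simp [hr]

/-- `D` is the multiset of the intervals in a decomposition of the one-parameter module `M` as a
finite direct sum of interval modules. -/
def IsDiagram {F : Type u} [Field F] (M : PersistenceModule.{u, w} F ℝ)
    (D : Multiset (ℝ × WithTop ℝ)) : Prop :=
  (∀ I ∈ D, (I.1 : WithTop ℝ) < I.2) ∧
    ∃ (n : ℕ) (I : Fin n → ℝ × WithTop ℝ),
      D = Finset.univ.val.map I ∧ M.Isomorphic (directSum fun j => interval F (I j))

/-- The persistence diagram of a one-parameter module (which is determined by the module as soon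
as the latter has a finite decomposition into interval modules). -/
noncomputable def dgm {F : Type u} [Field F] (M : PersistenceModule.{u, w} F ℝ) :
    Multiset (ℝ × WithTop ℝ) :=
  Classical.epsilon M.IsDiagram

end PersistenceModule

/-! ## The bottleneck distance -/

/-- The distance of two elements of `ℝ ∪ {∞}`, with `∞ - ∞ = 0` and `∞ - a = ∞`. -/
noncomputable def extDist : WithTop ℝ → WithTop ℝ → ℝ≥0∞
  | some x, some y => ENNReal.ofReal |x - y|
  | none, none => 0
  | _, _ => ∞

/-- The `ℓ^∞` distance of two points of `ℝ × (ℝ ∪ {∞})`. -/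
noncomputable def pairCost (p q : ℝ × WithTop ℝ) : ℝ≥0∞ :=
  max (extDist p.1 q.1) (extDist p.2 q.2)

/-- The `ℓ^∞` distance `(p₂ - p₁) / 2` of a point to the diagonal. -/
noncomputable def diagCost (p : ℝ × WithTop ℝ) : ℝ≥0∞ :=
  extDist p.1 p.2 / 2

/-- A matching between the multisets `A` and `B`, given as the multiset of its matched pairs: it is
a multi-bijection between a sub-multiset of `A` and a sub-multiset of `B`. -/
def IsMatching (A B : Multiset (ℝ × WithTop ℝ))
    (σ : Multiset ((ℝ × WithTop ℝ) × (ℝ × WithTop ℝ))) : Prop :=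
  σ.map Prod.fst ≤ A ∧ σ.map Prod.snd ≤ B

open Classical in
/-- The cost of a matching: the largest of the costs of its matched pairs and of the distances to
the diagonal of the unmatched points (and `0` if there are no points at all). -/
noncomputable def matchingCost (A B : Multiset (ℝ × WithTop ℝ))
    (σ : Multiset ((ℝ × WithTop ℝ) × (ℝ × WithTop ℝ))) : ℝ≥0∞ :=
  max (σ.map fun pq => pairCost pq.1 pq.2).sup
    (max ((A - σ.map Prod.fst).map diagCost).sup ((B - σ.map Prod.snd).map diagCost).sup)

/-- The bottleneck distance of two diagrams. -/
noncomputable def bottleneck (A B : Multiset (ℝ × WithTop ℝ)) : ℝ≥0∞ :=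
  ⨅ (σ : Multiset ((ℝ × WithTop ℝ) × (ℝ × WithTop ℝ))) (_ : IsMatching A B σ),
    matchingCost A B σ

/-! ## Lines of positive slope -/

/-- A line of positive slope, given by its unique parametrization `s ↦ s m + b` that satisfies the
standard normalization `max mᵢ = 1`, `b₀ + b₁ = 0`. -/
structure PosLine where
  m : Plane
  b : Plane
  m_pos : ∀ i, 0 < m i
  m_max : max (m 0) (m 1) = 1
  b_sum : b 0 + b 1 = 0

namespace PosLine

/-- The point of the line with parameter `s`. -/
def pt (L : PosLine) (s : ℝ) : Plane := s • L.m + L.b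

theorem pt_mono (L : PosLine) {s t : ℝ} (h : s ≤ t) : L.pt s ≤ L.pt t := by
  intro i
  simpa [pt] using mul_le_mul_of_nonneg_right h (L.m_pos i).le

theorem m_ne_zero (L : PosLine) : L.m ≠ 0 := fun h => by
  have := L.m_pos 0
  simp [h] at this

/-- The line as a subset of the plane. -/
def carrier (L : PosLine) : Set Plane := Set.range L.pt

/-- The weight of the line: the smaller coordinate of its direction vector. -/
noncomputable def weight (L : PosLine) : ℝ := min (L.m 0) (L.m 1)

/-- The parameter value of the push of `u` onto the line; see `carrier_inter_frontier`. -/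
noncomputable def pushParam (L : PosLine) (u : Plane) : ℝ :=
  max ((u 0 - L.b 0) / L.m 0) ((u 1 - L.b 1) / L.m 1)

/-- The line meets the boundary of the positive cone of `u` exactly in the point with parameter
`pushParam L u`. -/
theorem carrier_inter_frontier (L : PosLine) (u : Plane) :
    L.carrier ∩ frontier (Set.Ici u) = {L.pt (L.pushParam u)} := by
  have h0 := L.m_pos 0
  have h1 := L.m_pos 1
  have hfr : ∀ x : Plane, x ∈ frontier (Set.Ici u) ↔
      (u 0 ≤ x 0 ∧ u 1 ≤ x 1) ∧ ¬ (u 0 < x 0 ∧ u 1 < x 1) := by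
    intro x
    have hint : interior (Set.Ici u) = Set.pi Set.univ fun i => Set.Ioi (u i) := by
      rw [← Set.pi_univ_Ici, interior_pi_set Set.finite_univ]
      simp
    rw [isClosed_Ici.frontier_eq, hint]
    simp [Pi.le_def, Fin.forall_fin_two]
  have key : ∀ s : ℝ, L.pt s ∈ frontier (Set.Ici u) ↔ s = L.pushParam u := by
    intro s
    rw [hfr]
    have e : ∀ i, L.pt s i = s * L.m i + L.b i := fun i => by simp [pt]
    have a0 : u 0 ≤ L.pt s 0 ↔ (u 0 - L.b 0) / L.m 0 ≤ s := by
      rw [e, div_le_iff₀ h0]; constructor <;> intro h <;> linarith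
    have a1 : u 1 ≤ L.pt s 1 ↔ (u 1 - L.b 1) / L.m 1 ≤ s := by
      rw [e, div_le_iff₀ h1]; constructor <;> intro h <;> linarith
    have c0 : u 0 < L.pt s 0 ↔ (u 0 - L.b 0) / L.m 0 < s := by
      rw [e, div_lt_iff₀ h0]; constructor <;> intro h <;> linarith
    have c1 : u 1 < L.pt s 1 ↔ (u 1 - L.b 1) / L.m 1 < s := by
      rw [e, div_lt_iff₀ h1]; constructor <;> intro h <;> linarith
    rw [a0, a1, c0, c1, pushParam, ← max_le_iff, ← max_lt_iff, not_lt]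
    exact ⟨fun h => le_antisymm h.2 h.1, fun h => ⟨h.ge, h.le⟩⟩
  ext x
  constructor
  · rintro ⟨⟨s, rfl⟩, hx⟩
    rw [(key s).1 hx]; rfl
  · rintro rfl
    exact ⟨⟨_, rfl⟩, (key _).2 rfl⟩

end PosLine

/-- The restriction `M^L` of a two-parameter module to a line of positive slope. -/
def PersistenceModule.restrict {F : Type u} [Field F] (M : PersistenceModule.{u, w} F Plane)
    (L : PosLine) : PersistenceModule.{u, w} F ℝ where
  obj s := M.obj (L.pt s)
  map h := M.map (L.pt_mono h)
  map_refl s := M.map_refl (L.pt s)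
  map_trans hpq hqr := M.map_trans (L.pt_mono hpq) (L.pt_mono hqr)

/-- The weighted bottleneck distance of `M` and `N` along the line `L`. -/
noncomputable def weightedDist {F : Type u} [Field F] (M : PersistenceModule.{u, w₁} F Plane)
    (N : PersistenceModule.{u, w₂} F Plane) (L : PosLine) : ℝ≥0∞ :=
  ENNReal.ofReal L.weight * bottleneck (M.restrict L).dgm (N.restrict L).dgm

/-! ## The projective plane and the equivalence of lines -/

/-- The projective completion of the plane. -/
abbrev ProjPlane : Type := ℙ ℝ (Fin 3 → ℝ)

/-- The proper point `[1 : u₀ : u₁]`. -/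
noncomputable def proper (u : Plane) : ProjPlane :=
  Projectivization.mk ℝ ![1, u 0, u 1] fun h => by simpa using congrFun h 0

/-- The point `[0 : v₀ : v₁]` of the line at infinity. -/
noncomputable def atInfinity (v : Plane) (hv : v ≠ 0) : ProjPlane :=
  Projectivization.mk ℝ ![0, v 0, v 1] fun h => hv <| by
    ext i
    fin_cases i
    · simpa using congrFun h 1
    · simpa using congrFun h 2

/-- The point `[0 : 1 : 1]`, the direction of the diagonal lines. -/
noncomputable def diagonalPoint : ProjPlane :=
  atInfinity (fun _ => 1) fun h => by simpa using congrFun h 0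

/-- The set of points of the projective plane on the line: its proper points and its direction. -/
def PosLine.projCarrier (L : PosLine) : Set ProjPlane :=
  proper '' L.carrier ∪ {atInfinity L.m L.m_ne_zero}

/-- The pairs of real numbers that agree with `u` in the coordinates in `A`, and are larger than
`u` in the other ones. -/
def openFace (A : Set (Fin 2)) (u : Plane) : Set Plane :=
  {x | ∀ i, (i ∈ A → x i = u i) ∧ (i ∉ A → u i < x i)}

/-- The open faces `S_A(p)`, for the proper points `p = [1 : u₀ : u₁]` and for the points at
infinity `p = [0 : v₀ : v₁]` with `v₀, v₁ > 0`.  For the other points at infinity, through which no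
line of positive slope passes, the faces are empty. -/
def projFace (A : Set (Fin 2)) (p : ProjPlane) : Set ProjPlane :=
  {q | (∃ u x : Plane, p = proper u ∧ q = proper x ∧ x ∈ openFace A u) ∨
    (∃ (v x : Plane) (hv : v ≠ 0) (hx : x ≠ 0), (∀ i, 0 < v i) ∧
      p = atInfinity v hv ∧ q = atInfinity x hx ∧ x ∈ openFace A v)}

/-- The reciprocal position `A^L_p`: the largest subset `A` of the set of coordinates, among the
nonempty ones, for which the line meets the face `S_A(p)`. -/
def PosLine.position (L : PosLine) (p : ProjPlane) : Set (Fin 2) :=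
  ⋃₀ {A | A.Nonempty ∧ (L.projCarrier ∩ projFace A p).Nonempty}

/-- The lines have the same reciprocal position with respect to all the points of `U`. -/
def PosLine.Equivalent (U : Set ProjPlane) (L L' : PosLine) : Prop :=
  ∀ p ∈ U, L.position p = L'.position p

/-! ## The properties (P) and (Q), and the cost of vertical and horizontal lines -/

/-- Property (P) for the finite set `C` of critical values: with `closure C` the closure of `C`
under least upper bounds, the rank of the transition map from `p` to `q` is the rank of the one
from `p'` to `q'`, the largest elements of `closure C` below `p` and `q`, and it is zero if there
is no element of `closure C` below `p`. -/
def PropertyP {F : Type u} [Field F] (M : PersistenceModule.{u, w} F Plane) (C : Set Plane) :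
    Prop :=
  C.Finite ∧ ∀ (p q : Plane) (h : p ≤ q),
    (∀ (p' q' : Plane) (h' : p' ≤ q'), IsGreatest {c ∈ supClosure C | c ≤ p} p' →
      IsGreatest {c ∈ supClosure C | c ≤ q} q' → M.rank h = M.rank h') ∧
    ({c ∈ supClosure C | c ≤ p} = ∅ → M.rank h = 0)

/-- Property (Q) for the finite set `Ω` of switch points, where `K` is the set of all critical
values. -/
def PropertyQ (K : Set Plane) (Ω : Set ProjPlane) : Prop :=
  Ω.Finite ∧ ∀ c₁ ∈ K, ∀ c₂ ∈ K, ∀ c₃ ∈ K, ∀ c₄ ∈ K,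
    ∀ δ ∈ ({1, 2} : Set ℝ), ∀ η ∈ ({1, 2} : Set ℝ),
    ∀ L L' : PosLine, PosLine.Equivalent (proper '' K ∪ Ω) L L' →
      SignType.sign (|L.pushParam c₁ - L.pushParam c₂| / δ
          - |L.pushParam c₃ - L.pushParam c₄| / η) =
        SignType.sign (|L'.pushParam c₁ - L'.pushParam c₂| / δ
          - |L'.pushParam c₃ - L'.pushParam c₄| / η)

/-- `κ` is the cost of the line `{r | r i = a}`, which is vertical for `i = 0` and horizontal for
`i = 1`: for every point `r` of it, `κ` is the limit of the weighted bottleneck distance along the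
lines of positive slope through `r`, as the coordinate `mᵢ` of their (normalized) direction tends
to zero. -/
def IsAxisCost {F : Type u} [Field F] (M : PersistenceModule.{u, w₁} F Plane)
    (N : PersistenceModule.{u, w₂} F Plane) (i : Fin 2) (a : ℝ) (κ : ℝ≥0∞) : Prop :=
  ∀ r : Plane, r i = a →
    Tendsto (weightedDist M N)
      (comap (fun L : PosLine => L.m i) (𝓝[>] 0) ⊓ 𝓟 {L | r ∈ L.carrier}) (𝓝 κ)

end MatchingDistance

universe u w₁ w₂

/-!
The bars of `dgm M^L` begin and end at the parameters `p_L(c)` of critical values `c`, so they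
can be written with symbolic end points in the plane. For a fixed pair of symbolic diagrams the
bottleneck distance is the maximum of finitely many terms `|p_L(u) - p_L(v)| / k`, minimized over
finitely many matchings; hence it is given by one and the same term as long as the order of the
critical values and of the terms does not change, or changes only by strict inequalities becoming
equalities.

On the line `x i = μ * x j + c` with `0 < μ ≤ 1`, the weighted parameter of the push of `u` is
`max (u i) (μ * u j + c)` up to a constant. This is defined and continuous up to `μ = 0`, where
rank counts still determine the bars of positive length. So the weighted distances converge as
the lines tend to `x i = a`, and the limit is the value of a single term on the closure of the
whole cell of `(μ, c)` whose lines lie with respect to the critical values and the switch points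
as `x i = a` does.

The closed cell contains a line through two of the required points, at the largest possible `μ`.
From `x i = a` to this line the term `|p(u) - p(v)| / k` is constant if `u` and `v` both lie
right of `x i = a`, and it starts at `0` if both lie left of it. In the remaining case the cost
does not decrease when `x i = a` is moved left to the next critical value or switch point, and
the claim follows by induction on the number of these points left of `x i = a`.
-/

namespace MatchingDistance

universe w

/-! ## Partial matchings and the bottleneck distance -/

section Bottleneck

@[simp] theorem extDist_coe (x y : ℝ) : extDist (x : WithTop ℝ) y = ENNReal.ofReal |x - y| := rfl
@[simp] theorem extDist_top_top : extDist ⊤ ⊤ = 0 := rfl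
@[simp] theorem extDist_coe_top (x : ℝ) : extDist (x : WithTop ℝ) ⊤ = ∞ := rfl
@[simp] theorem extDist_top_coe (x : ℝ) : extDist ⊤ (x : WithTop ℝ) = ∞ := rfl

theorem extDist_self (x : WithTop ℝ) : extDist x x = 0 := by
  cases x <;> simp

theorem extDist_comm (x y : WithTop ℝ) : extDist x y = extDist y x := by
  cases x <;> cases y <;> simp [abs_sub_comm]

theorem extDist_triangle (x y z : WithTop ℝ) : extDist x z ≤ extDist x y + extDist y z := by
  cases x <;> cases y <;> cases z <;>
    simp only [extDist_coe, extDist_top_top, extDist_coe_top, extDist_top_coe, top_add, add_top,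
      add_zero, le_refl, le_top]
  rw [← ENNReal.ofReal_add (abs_nonneg _) (abs_nonneg _)]
  exact ENNReal.ofReal_le_ofReal (abs_sub_le _ _ _)

/-- A point `(b, d)` of a persistence diagram, with `d` possibly infinite.  The end points of a bar
need not be real numbers: bars over the plane are used as symbols for bars of the restrictions to
lines. -/
abbrev Bar (α : Type*) : Type _ := α × WithTop α

theorem pairCost_comm (x y : Bar ℝ) : pairCost x y = pairCost y x := by
  rw [pairCost, pairCost, extDist_comm x.1, extDist_comm x.2]

theorem diagCost_eq_zero {z : Bar ℝ} (hz : (z.1 : WithTop ℝ) = z.2) : diagCost z = 0 := by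
  rw [diagCost, hz, extDist_self, ENNReal.zero_div]

theorem diagCost_le_pairCost {z : Bar ℝ} (hz : (z.1 : WithTop ℝ) = z.2) (x : Bar ℝ) :
    diagCost x ≤ pairCost z x := by
  refine ENNReal.div_le_of_le_mul ?_
  calc extDist x.1 x.2 ≤ extDist x.1 z.1 + extDist z.2 x.2 := hz ▸ extDist_triangle _ _ _
    _ ≤ pairCost z x + pairCost z x :=
      add_le_add ((extDist_comm _ _).trans_le (le_max_left _ _)) (le_max_right _ _)
    _ = pairCost z x * 2 := (mul_two _).symm

/-- A partial matching of two multisets, `source` and `target`, given by its matched pairs and by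
the unmatched elements of both; this avoids the subtraction of multisets in `matchingCost`. -/
structure PartialMatching (α : Type*) where
  pairs : Multiset (α × α)
  left : Multiset α
  right : Multiset α

namespace PartialMatching

variable {α β : Type*}

/-- The multiset of all the elements on the left-hand side of a partial matching. -/
def source (P : PartialMatching α) : Multiset α := P.pairs.map Prod.fst + P.left

/-- The multiset of all the elements on the right-hand side of a partial matching. -/
def target (P : PartialMatching α) : Multiset α := P.pairs.map Prod.snd + P.right

/-- The inverse partial matching. -/
def swap (P : PartialMatching α) : PartialMatching α := ⟨P.pairs.map Prod.swap, P.right, P.left⟩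

/-- The image of a partial matching under a map. -/
def map (f : α → β) (P : PartialMatching α) : PartialMatching β :=
  ⟨P.pairs.map (Prod.map f f), P.left.map f, P.right.map f⟩

theorem source_swap (P : PartialMatching α) : P.swap.source = P.target := by
  simp [source, target, swap]

theorem target_swap (P : PartialMatching α) : P.swap.target = P.source := by
  simp [source, target, swap]

theorem source_map (f : α → β) (P : PartialMatching α) : (P.map f).source = P.source.map f := by
  simp [source, map]

theorem target_map (f : α → β) (P : PartialMatching α) : (P.map f).target = P.target.map f := by
  simp [target, map]

theorem exists_map_eq (f : α → β) (P : PartialMatching β) {A B : Multiset α}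
    (hA : P.source = A.map f) (hB : P.target = B.map f) :
    ∃ Q : PartialMatching α, Q.source = A ∧ Q.target = B ∧ Q.map f = P := by
  classical
  obtain ⟨σ, R, R'⟩ := P
  simp only [source, target] at hA hB
  induction σ using Multiset.induction_on generalizing A B with
  | empty => exact ⟨⟨0, A, B⟩, by simp [source], by simp [target], by simp_all [map]⟩
  | cons s σ ih =>
    rw [Multiset.map_cons, Multiset.cons_add, eq_comm, ← Multiset.map_eq_cons] at hA hB
    obtain ⟨a, ha, hfa, hA⟩ := hA
    obtain ⟨b, hb, hfb, hB⟩ := hB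
    obtain ⟨⟨τ, Q, Q'⟩, hQA, hQB, hQ⟩ := ih hA.symm hB.symm
    refine ⟨⟨(a, b) ::ₘ τ, Q, Q'⟩, ?_, ?_, ?_⟩ <;>
      simp_all [source, target, map, Multiset.cons_erase]

theorem finite_setOf_source_eq_target_eq (A B : Multiset α) :
    {P : PartialMatching α | P.source = A ∧ P.target = B}.Finite := by
  classical
  refine (((Set.finite_Iic (A.card • (A ×ˢ B))).prod ((Set.finite_Iic A).prod
    (Set.finite_Iic B))).image fun x => ⟨x.1, x.2.1, x.2.2⟩).subset ?_
  rintro P ⟨rfl, rfl⟩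
  refine ⟨(P.pairs, P.left, P.right), ⟨Multiset.le_iff_count.2 fun x => ?_,
    Multiset.le_add_left _ _, Multiset.le_add_left _ _⟩, rfl⟩
  by_cases hx : x ∈ P.pairs
  · have hmem : x ∈ P.source ×ˢ P.target := Multiset.mem_product.2
      ⟨Multiset.mem_add.2 (.inl (Multiset.mem_map_of_mem _ hx)),
        Multiset.mem_add.2 (.inl (Multiset.mem_map_of_mem _ hx))⟩
    have hcard : P.pairs.card ≤ P.source.card := by simp [source]
    rw [Multiset.count_nsmul]
    exact (Multiset.count_le_card _ _).trans (hcard.trans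
      (Nat.le_mul_of_pos_right _ (Multiset.count_pos.2 hmem)))
  · simp [Multiset.count_eq_zero_of_notMem hx]

/-- The cost of a partial matching of two diagrams. -/
noncomputable def cost (P : PartialMatching (Bar ℝ)) : ℝ≥0∞ :=
  (P.pairs.map fun x => pairCost x.1 x.2).sup ⊔ ((P.left + P.right).map diagCost).sup

theorem cost_le_iff {P : PartialMatching (Bar ℝ)} {r : ℝ≥0∞} :
    P.cost ≤ r ↔
      (∀ x ∈ P.pairs, pairCost x.1 x.2 ≤ r) ∧ ∀ x ∈ P.left + P.right, diagCost x ≤ r := by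
  simp only [cost, sup_le_iff, Multiset.sup_le, Multiset.forall_mem_map_iff]

theorem matchingCost_pairs (P : PartialMatching (Bar ℝ)) :
    matchingCost P.source P.target P.pairs = P.cost := by
  simp only [matchingCost, source, target, cost, add_tsub_cancel_left, Multiset.map_add,
    Multiset.sup_add]

theorem cost_swap_le (P : PartialMatching (Bar ℝ)) : P.swap.cost ≤ P.cost := by
  obtain ⟨hp, hd⟩ := cost_le_iff.1 (le_refl P.cost)
  refine cost_le_iff.2 ⟨Multiset.forall_mem_map_iff.2 fun x hx => ?_, ?_⟩
  · exact (pairCost_comm _ _).trans_le (hp x hx)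
  · rwa [swap, add_comm]

end PartialMatching

open PartialMatching

theorem bottleneck_le_cost (P : PartialMatching (Bar ℝ)) :
    bottleneck P.source P.target ≤ P.cost := by
  rw [← matchingCost_pairs]
  exact iInf₂_le P.pairs ⟨Multiset.le_add_right _ _, Multiset.le_add_right _ _⟩

theorem le_bottleneck {A B : Multiset (Bar ℝ)} {r : ℝ≥0∞}
    (h : ∀ P : PartialMatching (Bar ℝ), P.source = A → P.target = B → r ≤ P.cost) :
    r ≤ bottleneck A B := by
  refine le_iInf₂ fun σ hσ => ?_
  obtain ⟨R, rfl⟩ := Multiset.le_iff_exists_add.1 hσ.1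
  obtain ⟨R', rfl⟩ := Multiset.le_iff_exists_add.1 hσ.2
  exact (h ⟨σ, R, R'⟩ rfl rfl).trans_eq (matchingCost_pairs ⟨σ, R, R'⟩).symm

theorem bottleneck_comm (A B : Multiset (Bar ℝ)) : bottleneck A B = bottleneck B A := by
  have h : ∀ A B, bottleneck A B ≤ bottleneck B A := by
    refine fun A B => le_bottleneck ?_
    rintro P rfl rfl
    rw [← P.source_swap, ← P.target_swap]
    exact (bottleneck_le_cost _).trans P.cost_swap_le
  exact (h A B).antisymm (h B A)

theorem bottleneck_cons_le {z : Bar ℝ} (hz : (z.1 : WithTop ℝ) = z.2) (A B : Multiset (Bar ℝ)) :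
    bottleneck (z ::ₘ A) B ≤ bottleneck A B := by
  refine le_bottleneck ?_
  rintro P rfl rfl
  have h := bottleneck_le_cost { P with left := z ::ₘ P.left }
  simp only [source, Multiset.add_cons] at h
  obtain ⟨hp, hd⟩ := cost_le_iff.1 (le_refl P.cost)
  refine h.trans (cost_le_iff.2 ⟨hp, ?_⟩)
  simp only [Multiset.cons_add, Multiset.forall_mem_cons]
  exact ⟨(diagCost_eq_zero hz).trans_le zero_le, hd⟩

theorem le_bottleneck_cons {z : Bar ℝ} (hz : (z.1 : WithTop ℝ) = z.2) (A B : Multiset (Bar ℝ)) :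
    bottleneck A B ≤ bottleneck (z ::ₘ A) B := by
  refine le_bottleneck fun P hA hB => ?_
  obtain ⟨σ, R, R'⟩ := P
  obtain ⟨hp, hd⟩ := cost_le_iff.1 (le_refl (cost ⟨σ, R, R'⟩))
  rcases Multiset.mem_add.1 (hA ▸ Multiset.mem_cons_self z A) with hzσ | hzR
  · -- the partner of `z` becomes unmatched
    obtain ⟨⟨z, y⟩, hzy, rfl⟩ := Multiset.mem_map.1 hzσ
    obtain ⟨σ, rfl⟩ := Multiset.exists_cons_of_mem hzy
    simp only [source, target, Multiset.map_cons, Multiset.cons_add, Multiset.cons_inj_right]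
      at hA hB
    simp only [Multiset.forall_mem_cons] at hp
    rw [← hA, ← hB, ← Multiset.add_cons]
    refine (bottleneck_le_cost ⟨σ, R, y ::ₘ R'⟩).trans (cost_le_iff.2 ⟨hp.2, ?_⟩)
    rw [Multiset.add_cons]
    exact Multiset.forall_mem_cons.2 ⟨(diagCost_le_pairCost hz y).trans hp.1, hd⟩
  · obtain ⟨R, rfl⟩ := Multiset.exists_cons_of_mem hzR
    simp only [source, Multiset.add_cons, Multiset.cons_inj_right] at hA
    rw [← hA, ← hB]
    simp only [Multiset.cons_add, Multiset.forall_mem_cons] at hd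
    exact (bottleneck_le_cost ⟨σ, R, R'⟩).trans (cost_le_iff.2 ⟨hp, hd.2⟩)

theorem bottleneck_add_left {Z : Multiset (Bar ℝ)} (hZ : ∀ z ∈ Z, (z.1 : WithTop ℝ) = z.2)
    (A B : Multiset (Bar ℝ)) : bottleneck (Z + A) B = bottleneck A B := by
  induction Z using Multiset.induction_on with
  | empty => rw [zero_add]
  | cons z Z ih =>
    obtain ⟨hz, hZ⟩ := Multiset.forall_mem_cons.1 hZ
    rw [Multiset.cons_add, ← ih hZ]
    exact (bottleneck_cons_le hz _ _).antisymm (le_bottleneck_cons hz _ _)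

open Classical in
/-- The points of a diagram off the diagonal. -/
noncomputable def offDiag (D : Multiset (Bar ℝ)) : Multiset (Bar ℝ) :=
  D.filter fun x => (x.1 : WithTop ℝ) < x.2

theorem bottleneck_offDiag_left {A : Multiset (Bar ℝ)} (hA : ∀ x ∈ A, (x.1 : WithTop ℝ) ≤ x.2)
    (B : Multiset (Bar ℝ)) : bottleneck (offDiag A) B = bottleneck A B := by
  classical
  rw [← bottleneck_add_left (Z := A.filter fun x => ¬(x.1 : WithTop ℝ) < x.2), offDiag, add_comm]
  · congr!
    convert Multiset.filter_add_not _ A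
  · intro z hz
    obtain ⟨hz, hz'⟩ := Multiset.mem_filter.1 hz
    exact (hA z hz).antisymm (not_lt.1 hz')

theorem bottleneck_congr_offDiag {A A' B B' : Multiset (Bar ℝ)}
    (hA : ∀ x ∈ A, (x.1 : WithTop ℝ) ≤ x.2) (hA' : ∀ x ∈ A', (x.1 : WithTop ℝ) ≤ x.2)
    (hB : ∀ x ∈ B, (x.1 : WithTop ℝ) ≤ x.2) (hB' : ∀ x ∈ B', (x.1 : WithTop ℝ) ≤ x.2)
    (h : offDiag A = offDiag A') (h' : offDiag B = offDiag B') :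
    bottleneck A B = bottleneck A' B' := by
  rw [← bottleneck_offDiag_left hA, h, bottleneck_offDiag_left hA', bottleneck_comm,
    ← bottleneck_offDiag_left hB, h', bottleneck_offDiag_left hB', bottleneck_comm]

end Bottleneck

/-! ## Order-compatible functions -/

section OrderCompat

variable {X Y : Type*} [Preorder Y] {S : Set X} {f g : X → Y}

/-- The values of `g` on `S` satisfy all the weak inequalities between the values of `f`; so `g`
may only collapse distinct values of `f`. -/
def OrderCompat (S : Set X) (f g : X → Y) : Prop :=
  ∀ a ∈ S, ∀ b ∈ S, f a ≤ f b → g a ≤ g b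

namespace OrderCompat

theorem refl (S : Set X) (f : X → Y) : OrderCompat S f f := fun _ _ _ _ h => h

theorem monotone_comp (h : OrderCompat S f g) {φ : Y → Y} (hφ : Monotone φ) :
    OrderCompat S f (φ ∘ g) :=
  fun a ha b hb hab => hφ (h a ha b hb hab)

theorem of_tendsto [TopologicalSpace Y] [OrderClosedTopology Y] {ι : Type*} {l : Filter ι} [l.NeBot]
    {G : ι → X → Y} (h : ∀ᶠ i in l, OrderCompat S f (G i))
    (hG : ∀ a ∈ S, Tendsto (fun i => G i a) l (𝓝 (g a))) : OrderCompat S f g :=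
  fun a ha b hb hab => le_of_tendsto_of_tendsto (hG a ha) (hG b hb)
    (h.mono fun _ hi => hi a ha b hb hab)

/-- Along an ultrafilter, each of the finitely many comparisons is eventually constant. -/
theorem exists_eventually (hS : S.Finite) {ι : Type*} (U : Ultrafilter ι) (G : ι → X → Y) :
    ∀ᶠ i in U, ∀ᶠ k in U, OrderCompat S (G i) (G k) := by
  have hconst : ∀ x ∈ S ×ˢ S, (∀ᶠ k in U, G k x.1 ≤ G k x.2) ∨ ∀ᶠ k in U, ¬G k x.1 ≤ G k x.2 :=
    fun x _ => Ultrafilter.eventually_or.1 (Eventually.of_forall fun _ => em _)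
  have hev : ∀ᶠ i in U, ∀ x ∈ S ×ˢ S, G i x.1 ≤ G i x.2 → ∀ᶠ k in U, G k x.1 ≤ G k x.2 := by
    refine (eventually_all_finite (hS.prod hS)).2 fun x hx => ?_
    rcases hconst x hx with h | h
    · exact Eventually.of_forall fun _ _ => h
    · exact h.mono fun _ hi hi' => absurd hi' hi
  filter_upwards [hev] with i hi
  have hi' : ∀ᶠ k in U, ∀ x ∈ S ×ˢ S, G i x.1 ≤ G i x.2 → G k x.1 ≤ G k x.2 := by
    refine (eventually_all_finite (hS.prod hS)).2 fun x hx => ?_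
    by_cases h : G i x.1 ≤ G i x.2
    · exact (hi x hx h).mono fun _ hk _ => hk
    · exact Eventually.of_forall fun _ h' => absurd h' h
  exact hi'.mono fun k hk a ha b hb => hk (a, b) ⟨ha, hb⟩

end OrderCompat

end OrderCompat

/-! ## The bottleneck distance of diagrams with symbolic end points -/

section Symbolic

variable {α : Type*} {A B : Multiset (Bar α)} {K K' : Set α} {g g₀ : α → ℝ}

/-- The evaluation of a bar with symbolic end points. -/
def evalBar (g : α → ℝ) (x : Bar α) : Bar ℝ := (g x.1, x.2.map g)

/-- The symbols for the elements of `K`, and `∞`. -/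
def extend (K : Set α) : Set (WithTop α) := insert ⊤ ((↑) '' K)

/-- The end points of the bars lie in `K`, up to infinite ones. -/
def EndpointsIn (A : Multiset (Bar α)) (K : Set α) : Prop :=
  ∀ x ∈ A, x.1 ∈ K ∧ x.2 ∈ extend K

/-- A symbol `(x, y, k)` for the number `|x - y| / k`. -/
abbrev CostTerm (α : Type*) : Type _ := WithTop α × WithTop α × ℕ

/-- The symbols that may stand for the cost of a matching of diagrams with end points in `K`. -/
def costTerms (K : Set α) : Set (CostTerm α) :=
  extend K ×ˢ extend K ×ˢ {1, 2}

/-- The number for which a symbol stands. -/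
noncomputable def termValue (g : α → ℝ) (x : CostTerm α) : ℝ≥0∞ :=
  extDist (x.1.map g) (x.2.1.map g) / x.2.2

theorem extend_mono (h : K ⊆ K') : extend K ⊆ extend K' :=
  Set.insert_subset_insert (Set.image_mono h)

theorem EndpointsIn.mono (hA : EndpointsIn A K) (h : K ⊆ K') : EndpointsIn A K' :=
  fun x hx => ⟨h (hA x hx).1, extend_mono h (hA x hx).2⟩

theorem costTerms_mono (h : K ⊆ K') : costTerms K ⊆ costTerms K' :=
  Set.prod_mono (extend_mono h) (Set.prod_mono_left (extend_mono h))

theorem costTerms_finite (hK : K.Finite) : (costTerms K).Finite :=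
  have h : (extend K).Finite := (hK.image _).insert _
  h.prod (h.prod (Set.toFinite _))

theorem termValue_coe_coe (g : α → ℝ) (u v : α) {k : ℕ} (hk : 0 < k) :
    termValue g (u, v, k) = ENNReal.ofReal (|g u - g v| / k) := by
  rw [ENNReal.ofReal_div_of_pos (Nat.cast_pos.2 hk), ENNReal.ofReal_natCast]
  rfl

theorem termValue_top_top (g : α → ℝ) (k : ℕ) : termValue g (⊤, ⊤, k) = 0 := by
  simp [termValue]

theorem termValue_coe_top (g : α → ℝ) (u : α) (k : ℕ) : termValue g (u, ⊤, k) = ∞ := by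
  simp [termValue, ENNReal.top_div]

theorem termValue_top_coe (g : α → ℝ) (u : α) (k : ℕ) : termValue g (⊤, u, k) = ∞ := by
  simp [termValue, ENNReal.top_div]

theorem pos_of_mem_one_two {k : ℕ} (hk : k ∈ ({1, 2} : Set ℕ)) : 0 < k := by
  rcases hk with rfl | rfl <;> norm_num

theorem tendsto_termValue {ι : Type*} {l : Filter ι} {G : ι → α → ℝ}
    (h : ∀ u ∈ K, Tendsto (fun i => G i u) l (𝓝 (g u))) {x : CostTerm α}
    (hx : x ∈ costTerms K) : Tendsto (fun i => termValue (G i) x) l (𝓝 (termValue g x)) := by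
  obtain ⟨x, y, k⟩ := x
  obtain ⟨rfl | ⟨u, hu, rfl⟩, rfl | ⟨v, hv, rfl⟩, hk⟩ := hx
  · simp only [termValue_top_top, tendsto_const_nhds]
  · simp only [termValue_top_coe, tendsto_const_nhds]
  · simp only [termValue_coe_top, tendsto_const_nhds]
  · simp only [termValue_coe_coe _ _ _ (pos_of_mem_one_two hk)]
    exact ENNReal.tendsto_ofReal ((((h u hu).sub (h v hv)).abs).div_const _)

theorem termValue_affine {m β : ℝ} (hm : 0 < m) (h : ∀ u, g u = m * g₀ u + β)
    (x : CostTerm α) : termValue g x = ENNReal.ofReal m * termValue g₀ x := by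
  obtain ⟨x, y, k⟩ := x
  have hm' : ENNReal.ofReal m ≠ 0 := (ENNReal.ofReal_pos.2 hm).ne'
  simp only [termValue, ← mul_div_assoc]
  cases x <;> cases y
  · simp
  · simp [ENNReal.mul_top hm']
  · simp [ENNReal.mul_top hm']
  · rw [WithTop.map_coe, WithTop.map_coe, extDist_coe, WithTop.map_coe, WithTop.map_coe,
      extDist_coe, ← ENNReal.ofReal_mul hm.le, h, h, add_sub_add_right_eq_sub, ← mul_sub, abs_mul,
      abs_of_pos hm]

namespace PartialMatching

/-- The terms whose maximum is the cost of a partial matching of diagrams with symbolic end points;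
the vanishing term `|∞ - ∞|` is added so that there always is one. -/
def terms (P : PartialMatching (Bar α)) : Multiset (CostTerm α) :=
  (⊤, ⊤, 1) ::ₘ (P.pairs.map (fun x => ((x.1.1 : WithTop α), (x.2.1 : WithTop α), 1)) +
    P.pairs.map (fun x => (x.1.2, x.2.2, 1)) +
    (P.left + P.right).map fun x => ((x.1 : WithTop α), x.2, 2))

theorem cost_map_le_iff {P : PartialMatching (Bar α)} {r : ℝ≥0∞} :
    (P.map (evalBar g)).cost ≤ r ↔ ∀ x ∈ P.terms, termValue g x ≤ r := by
  rw [cost_le_iff]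
  simp only [map, terms, evalBar, ← Multiset.map_add, Multiset.forall_mem_cons, Multiset.mem_add,
    or_imp, forall_and, Multiset.forall_mem_map_iff, zero_le, true_and, WithTop.map_top,
    extDist_top_top, pairCost, diagCost, termValue, WithTop.map_coe, Prod.map_fst, Prod.map_snd,
    max_le_iff, Nat.cast_one, div_one, Nat.cast_ofNat]

theorem mem_costTerms {P : PartialMatching (Bar α)} (hs : EndpointsIn P.source K)
    (ht : EndpointsIn P.target K) {x : CostTerm α} (hx : x ∈ P.terms) :
    x ∈ costTerms K := by
  have hcoe : ∀ {c : α}, c ∈ K → (c : WithTop α) ∈ extend K := fun hc => .inr ⟨_, hc, rfl⟩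
  simp only [source, target, EndpointsIn, Multiset.mem_add, or_imp, forall_and,
    Multiset.forall_mem_map_iff] at hs ht
  simp only [terms, Multiset.mem_cons, Multiset.mem_add, Multiset.mem_map] at hx
  rcases hx with rfl | (⟨y, hy, rfl⟩ | ⟨y, hy, rfl⟩) | ⟨y, hy | hy, rfl⟩
  · exact ⟨.inl rfl, .inl rfl, .inl rfl⟩
  · exact ⟨hcoe (hs.1.1 y hy), hcoe (ht.1.1 y hy), .inl rfl⟩
  · exact ⟨hs.2.1 y hy, ht.2.1 y hy, .inl rfl⟩
  · exact ⟨hcoe (hs.1.2 y hy), hs.2.2 y hy, .inr rfl⟩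
  · exact ⟨hcoe (ht.1.2 y hy), ht.2.2 y hy, .inr rfl⟩

theorem exists_max_term (P : PartialMatching (Bar α)) (g : α → ℝ) :
    ∃ x ∈ P.terms, ∀ y ∈ P.terms, termValue g y ≤ termValue g x := by
  classical
  obtain ⟨x, hx, h⟩ := P.terms.toFinset.exists_max_image (termValue g)
    ⟨_, Multiset.mem_toFinset.2 (Multiset.mem_cons_self _ _)⟩
  exact ⟨x, Multiset.mem_toFinset.1 hx, fun y hy => h y (Multiset.mem_toFinset.2 hy)⟩

end PartialMatching

open PartialMatching

/-- The minimum over the partial matchings of the maximum of their terms is attained at a term that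
depends only on the order of the values of the terms. -/
theorem exists_term_bottleneck (hA : EndpointsIn A K) (hB : EndpointsIn B K) (g₀ : α → ℝ) :
    ∃ x ∈ costTerms K, ∀ g, OrderCompat (costTerms K) (termValue g₀) (termValue g) →
      bottleneck (A.map (evalBar g)) (B.map (evalBar g)) = termValue g x := by
  obtain ⟨P, ⟨rfl, rfl⟩, hmin⟩ := Set.exists_min_image _
    (fun P : PartialMatching (Bar α) => (P.map (evalBar g₀)).cost)
    (finite_setOf_source_eq_target_eq A B) ⟨⟨0, A, B⟩, by simp [source], by simp [target]⟩
  obtain ⟨x, hx, hmax⟩ := P.exists_max_term g₀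
  have hxK := mem_costTerms hA hB hx
  refine ⟨x, hxK, fun g hg => le_antisymm ?_ (le_bottleneck fun P' hs ht => ?_)⟩
  · rw [← source_map, ← target_map]
    exact (bottleneck_le_cost _).trans
      (cost_map_le_iff.2 fun y hy => hg y (mem_costTerms hA hB hy) x hxK (hmax y hy))
  · obtain ⟨Q, hQs, hQt, rfl⟩ := exists_map_eq (evalBar g) P' hs ht
    obtain ⟨y, hy, hQmax⟩ := Q.exists_max_term g₀
    have hxy : termValue g₀ x ≤ termValue g₀ y :=
      calc termValue g₀ x ≤ (P.map (evalBar g₀)).cost := cost_map_le_iff.1 le_rfl x hx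
        _ ≤ (Q.map (evalBar g₀)).cost := hmin Q ⟨hQs, hQt⟩
        _ ≤ termValue g₀ y := cost_map_le_iff.2 hQmax
    exact (hg x hxK y (mem_costTerms (hQs ▸ hA) (hQt ▸ hB) hy) hxy).trans
      (cost_map_le_iff.1 le_rfl y hy)

theorem bottleneck_affine (A B : Multiset (Bar α)) {m β : ℝ} (hm : 0 < m)
    (h : ∀ u, g u = m * g₀ u + β) :
    bottleneck (A.map (evalBar g)) (B.map (evalBar g)) =
      ENNReal.ofReal m * bottleneck (A.map (evalBar g₀)) (B.map (evalBar g₀)) := by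
  have huniv : ∀ A : Multiset (Bar α), EndpointsIn A Set.univ :=
    fun A x _ => ⟨trivial, by cases x.2 <;> simp [extend]⟩
  obtain ⟨x, -, hx⟩ := exists_term_bottleneck (huniv A) (huniv B) g₀
  rw [hx g₀ (.refl _ _), hx g, termValue_affine hm h]
  rw [funext (termValue_affine hm h)]
  exact (OrderCompat.refl _ _).monotone_comp (φ := (ENNReal.ofReal m * ·))
    fun _ _ h => mul_le_mul_right h _

end Symbolic

/-! ## Interval decompositions of tame one-parameter modules -/

namespace PersistenceModule

variable {F : Type u} [Field F]

section Maps

variable {P : Type} [Preorder P] (X : PersistenceModule.{u, w} F P)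

theorem map_map {p q r : P} (hpq : p ≤ q) (hqr : q ≤ r) (x : X.obj p) :
    X.map hqr (X.map hpq x) = X.map (hpq.trans hqr) x :=
  LinearMap.congr_fun (X.map_trans hpq hqr) x

theorem map_self {p : P} (h : p ≤ p) (x : X.obj p) : X.map h x = x :=
  LinearMap.congr_fun (X.map_refl p) x

end Maps

/-- A family of vectors and a family of functionals that together split the interval module `I` off
`X`. -/
structure Splitting (X : PersistenceModule.{u, w} F ℝ) (I : ℝ × WithTop ℝ) where
  vec : ∀ t, X.obj t
  fn : ∀ t, X.obj t →ₗ[F] F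
  map_vec : ∀ {s t : ℝ} (h : s ≤ t), InInterval I s → InInterval I t → X.map h (vec s) = vec t
  map_vec_zero : ∀ {s t : ℝ} (h : s ≤ t), InInterval I s → ¬ InInterval I t →
    X.map h (vec s) = 0
  fn_map : ∀ {s t : ℝ} (h : s ≤ t), InInterval I t → ∀ y, fn t (X.map h y) = fn s y
  fn_zero : ∀ t, ¬ InInterval I t → fn t = 0
  fn_vec : ∀ t, InInterval I t → fn t (vec t) = 1

namespace Splitting

variable {X : PersistenceModule.{u, w} F ℝ} {I : ℝ × WithTop ℝ} (S : X.Splitting I)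

theorem fn_map_eq_zero {s t : ℝ} (h : s ≤ t) {y : X.obj s} (hy : S.fn s y = 0) :
    S.fn t (X.map h y) = 0 := by
  by_cases ht : InInterval I t
  · rw [S.fn_map h ht, hy]
  · rw [S.fn_zero t ht, LinearMap.zero_apply]

/-- The complement of the interval module split off by `S`: the common kernel of the
functionals. -/
def complement : PersistenceModule.{u, w} F ℝ where
  obj t := LinearMap.ker (S.fn t)
  map {s t} h := (X.map h).restrict fun _ hy => S.fn_map_eq_zero h hy
  map_refl t := by
    ext y
    exact X.map_self _ _
  map_trans hpq hqr := by
    ext y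
    exact X.map_map hpq hqr _

/-- The projection of the module onto the interval module split off by `S`. -/
def coeff (t : ℝ) : X.obj t →ₗ[F] (interval F I).obj t :=
  (S.fn t).codRestrict (intervalSpace F I t) fun y ht => by
    rw [S.fn_zero t ht, LinearMap.zero_apply]

/-- The projection of the module onto the complement. -/
def proj (t : ℝ) : X.obj t →ₗ[F] S.complement.obj t :=
  (LinearMap.id - (S.fn t).smulRight (S.vec t)).codRestrict (LinearMap.ker (S.fn t)) fun y => by
    by_cases ht : InInterval I t
    · simp [S.fn_vec t ht]
    · simp [S.fn_zero t ht]

theorem coe_proj {t : ℝ} (y : X.obj t) : (S.proj t y).1 = y - S.fn t y • S.vec t :=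
  rfl

theorem coeff_map {s t : ℝ} (h : s ≤ t) (y : X.obj s) :
    S.coeff t (X.map h y) = (interval F I).map h (S.coeff s y) := by
  refine Subtype.ext (?_ : S.fn t (X.map h y) = _)
  by_cases ht : InInterval I t
  · simp only [interval, ht, if_true]
    exact S.fn_map h ht y
  · simp only [interval, ht, if_false, S.fn_zero t ht]
    rfl

theorem proj_map {s t : ℝ} (h : s ≤ t) (y : X.obj s) :
    S.proj t (X.map h y) = S.complement.map h (S.proj s y) := by
  refine Subtype.ext (?_ : _ = X.map h (S.proj s y).1)
  simp only [coe_proj, map_sub, map_smul, sub_right_inj]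
  by_cases ht : InInterval I t
  · by_cases hs : InInterval I s
    · rw [S.fn_map h ht, S.map_vec h hs ht]
    · rw [S.fn_map h ht, S.fn_zero s hs, LinearMap.zero_apply, zero_smul, zero_smul]
  · by_cases hs : InInterval I s
    · rw [S.fn_zero t ht, S.map_vec_zero h hs ht, LinearMap.zero_apply, zero_smul, smul_zero]
    · rw [S.fn_zero t ht, S.fn_zero s hs, LinearMap.zero_apply, LinearMap.zero_apply, zero_smul,
        zero_smul]

theorem proj_coe {t : ℝ} (z : S.complement.obj t) : S.proj t z.1 = z := by
  have hz : S.fn t z.1 = 0 := z.2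
  refine Subtype.ext ?_
  rw [coe_proj, hz, zero_smul, sub_zero]

theorem fn_smul_vec {t : ℝ} (c : (interval F I).obj t) : S.fn t (c.1 • S.vec t) = c.1 := by
  by_cases ht : InInterval I t
  · rw [map_smul, S.fn_vec t ht, smul_eq_mul, mul_one]
  · rw [c.2 ht, zero_smul, map_zero]

/-- The splitting of the space of the module at `t`. -/
noncomputable def equiv (t : ℝ) : X.obj t ≃ₗ[F] (interval F I).obj t × S.complement.obj t where
  __ := (S.coeff t).prod (S.proj t)
  invFun z := z.1.1 • S.vec t + z.2.1
  left_inv y := add_sub_cancel (S.fn t y • S.vec t) y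
  right_inv z := by
    have hz : S.fn t (z.1.1 • S.vec t + z.2.1) = z.1.1 := by
      rw [map_add, S.fn_smul_vec, show S.fn t z.2.1 = 0 from z.2.2, add_zero]
    refine Prod.ext (Subtype.ext hz) (Subtype.ext (?_ : (S.proj t _).1 = _))
    rw [coe_proj, hz, add_sub_cancel_left]

theorem isomorphic_cons {n : ℕ} {J : Fin n → ℝ × WithTop ℝ}
    (h : S.complement.Isomorphic (directSum fun j => interval F (J j))) :
    X.Isomorphic
      (directSum fun j => interval F (Fin.cons (α := fun _ => ℝ × WithTop ℝ) I J j)) := by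
  obtain ⟨e, he⟩ := h
  refine ⟨fun t => (S.equiv t).trans (((LinearEquiv.refl F _).prodCongr (e t)).trans
    (Fin.consLinearEquiv F fun j : Fin (n + 1) =>
      (interval F (Fin.cons (α := fun _ => ℝ × WithTop ℝ) I J j)).obj t)), fun s t h y => ?_⟩
  refine funext fun j => Fin.cases ?_ (fun j => ?_) j
  · exact S.coeff_map h y
  · exact congrFun ((congrArg (e t) (S.proj_map h y)).trans (he s t h (S.proj s y))) j

theorem pointwiseFinite_complement (hX : X.PointwiseFinite) : S.complement.PointwiseFinite :=
  fun t =>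
    have := hX t
    inferInstanceAs (Module.Finite F (LinearMap.ker (S.fn t)))

theorem finrank_complement_le (hX : X.PointwiseFinite) (t : ℝ) :
    Module.finrank F (S.complement.obj t) ≤ Module.finrank F (X.obj t) :=
  have := hX t
  Submodule.finrank_le (LinearMap.ker (S.fn t))

theorem finrank_complement_lt (hX : X.PointwiseFinite) {t : ℝ} (ht : InInterval I t) :
    Module.finrank F (S.complement.obj t) < Module.finrank F (X.obj t) := by
  have := hX t
  refine Submodule.finrank_lt (s := LinearMap.ker (S.fn t)) fun h => one_ne_zero (α := F) ?_
  rw [← S.fn_vec t ht, LinearMap.ker_eq_top.1 h, LinearMap.zero_apply]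

end Splitting

/-- The transition maps are bijective away from the finite set `T`, and the module vanishes to the
left of `T`. -/
def Tame (X : PersistenceModule.{u, w} F ℝ) (T : Finset ℝ) : Prop :=
  (∀ (s t : ℝ) (h : s ≤ t), (∀ τ ∈ T, τ ≤ t → τ ≤ s) → Function.Bijective (X.map h)) ∧
    ∀ s : ℝ, (∀ τ ∈ T, s < τ) → Subsingleton (X.obj s)

theorem Splitting.tame_complement {X : PersistenceModule.{u, w} F ℝ} {I : ℝ × WithTop ℝ}
    (S : X.Splitting I) {T : Finset ℝ} (hT : X.Tame T) : S.complement.Tame T := by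
  refine ⟨fun s t h hst => ⟨fun y z hyz => ?_, fun y => ?_⟩, fun s hs => ?_⟩
  · exact Subtype.ext ((hT.1 s t h hst).1 (congrArg Subtype.val hyz))
  · obtain ⟨z, hz⟩ := (hT.1 s t h hst).2 y.1
    exact ⟨S.proj s z, by rw [← S.proj_map, hz, S.proj_coe]⟩
  · have := hT.2 s hs
    exact inferInstanceAs (Subsingleton (LinearMap.ker (S.fn s)))

theorem exists_natural_functional {P : Type} [LinearOrder P] (X : PersistenceModule.{u, w} F P)
    {S : Set P} {a : P} (ha : a ∈ S)
    (hbij : ∀ v (h : a ≤ v), v ∈ S → Function.Bijective (X.map h)) (φ : X.obj a →ₗ[F] F) :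
    ∃ ℓ : ∀ t, X.obj t →ₗ[F] F, ℓ a = φ ∧
      ∀ s t (h : s ≤ t), s ∈ S → t ∈ S → ∀ y, ℓ t (X.map h y) = ℓ s y := by
  have hmax : ∀ t ∈ S, Function.Bijective (X.map (le_max_left a t)) := fun t ht =>
    hbij _ _ (max_rec' (· ∈ S) ha ht)
  have hex : ∀ t, ∃ ℓ : X.obj t →ₗ[F] F, t ∈ S → ∀ y z,
      X.map (le_max_left a t) z = X.map (le_max_right a t) y → ℓ y = φ z := by
    intro t
    by_cases ht : t ∈ S
    · let e := LinearEquiv.ofBijective _ (hmax t ht)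
      refine ⟨φ ∘ₗ e.symm.toLinearMap ∘ₗ X.map (le_max_right a t), fun _ y z hyz => ?_⟩
      exact congrArg φ (e.symm_apply_eq.2 hyz.symm)
    · exact ⟨0, fun h => absurd h ht⟩
  choose ℓ hℓ using hex
  refine ⟨ℓ, LinearMap.ext fun z => hℓ a ha z z rfl, fun s t h hs ht y => ?_⟩
  obtain ⟨z, hz⟩ := (hmax s hs).2 (X.map (le_max_right a s) y)
  rw [hℓ s hs y z hz]
  refine hℓ t ht _ z ?_
  have hz' := congrArg (X.map (max_le_max_left a h)) hz
  rwa [map_map, map_map, ← X.map_map h (le_max_right a t)] at hz'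

theorem exists_last_of_mem {α : Type*} [LinearOrder α] {T : Finset α} {b : α} (hb : b ∈ T)
    {p : α → Prop} (hp : p b) : ∃ a ∈ T, p a ∧ ∀ r ∈ T, p r → r ≤ a := by
  classical
  obtain ⟨a, ha, hmax⟩ :=
    (T.filter p).exists_max_image id ⟨b, Finset.mem_filter.2 ⟨hb, hp⟩⟩
  rw [Finset.mem_filter] at ha
  exact ⟨a, ha.1, ha.2, fun r hr hpr => hmax r (Finset.mem_filter.2 ⟨hr, hpr⟩)⟩

namespace Tame

variable {X : PersistenceModule.{u, w} F ℝ} {T : Finset ℝ} (hT : X.Tame T)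
include hT

theorem subsingleton {t : ℝ} (h : ∀ τ ∈ T, τ ≤ t → Subsingleton (X.obj τ)) :
    Subsingleton (X.obj t) := by
  by_cases hne : ∃ τ ∈ T, τ ≤ t
  · obtain ⟨b, hb, hbt⟩ := hne
    obtain ⟨a, ha, hat, hlast⟩ := exists_last_of_mem hb (p := (· ≤ t)) hbt
    have := h a ha hat
    exact (hT.1 a t hat hlast).2.subsingleton
  · push Not at hne
    exact hT.2 t hne

theorem exists_death {b : ℝ} (hb : b ∈ T) {x : X.obj b} (hx : x ≠ 0) :
    ∃ d : WithTop ℝ, (b : WithTop ℝ) < d ∧ ∀ t (h : b ≤ t), X.map h x = 0 ↔ d ≤ t := by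
  classical
  let D := T.filter fun τ => ∃ h : b ≤ τ, X.map h x = 0
  have hD : ∀ t (h : b ≤ t), X.map h x = 0 → ∃ τ ∈ D, τ ≤ t := by
    intro t h h0
    obtain ⟨τ, hτ, hτt, hlast⟩ := exists_last_of_mem hb (p := (· ≤ t)) h
    refine ⟨τ, Finset.mem_filter.2 ⟨hτ, hlast b hb h, (hT.1 τ t hτt hlast).1 ?_⟩, hτt⟩
    rw [map_map, h0, map_zero]
  by_cases hne : D.Nonempty
  · obtain ⟨-, hbd, h0⟩ := Finset.mem_filter.1 (D.min'_mem hne)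
    refine ⟨D.min' hne, WithTop.coe_lt_coe.2 (hbd.lt_of_ne fun he => hx ?_), fun t h => ?_⟩
    · rw [← X.map_self le_rfl x]
      convert h0
    · rw [WithTop.coe_le_coe]
      refine ⟨fun h0 => ?_, fun hdt => by rw [← X.map_map hbd hdt, h0, map_zero]⟩
      obtain ⟨τ, hτ, hτt⟩ := hD t h h0
      exact (D.min'_le τ hτ).trans hτt
  · refine ⟨⊤, WithTop.coe_lt_top b, fun t h => iff_of_false (fun h0 => ?_) (by simp)⟩
    obtain ⟨τ, hτ, -⟩ := hD t h h0
    exact hne ⟨τ, hτ⟩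

/-- The interval is spanned by a vector born at `b`.  A functional that is `1` on it just before its
death extends to the whole interval, since the module does not change there. -/
theorem exists_splitting {b : ℝ} (hb : b ∈ T) (hlt : ∀ t < b, Subsingleton (X.obj t))
    (hnt : Nontrivial (X.obj b)) :
    ∃ d : WithTop ℝ, (b : WithTop ℝ) < d ∧ Nonempty (X.Splitting (b, d)) := by
  classical
  obtain ⟨x, hx⟩ := exists_ne (0 : X.obj b)
  obtain ⟨d, hbd, hdeath⟩ := hT.exists_death hb hx
  obtain ⟨a, -, had, hlast⟩ := exists_last_of_mem hb (p := fun τ => (τ : WithTop ℝ) < d) hbd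
  have hba : b ≤ a := hlast b hb hbd
  obtain ⟨φ, hφ⟩ : ∃ φ : Module.Dual F (X.obj a), φ (X.map hba x) = 1 :=
    Module.Projective.exists_dual_eq_one F fun h => ((hdeath a hba).1 h).not_gt had
  have hbij : ∀ v (h : a ≤ v), InInterval (b, d) v → Function.Bijective (X.map h) :=
    fun v h hv => hT.1 a v h fun r hr hrv =>
      hlast r hr ((WithTop.coe_le_coe.2 hrv).trans_lt hv.2)
  obtain ⟨ℓ, rfl, hℓ⟩ := X.exists_natural_functional (S := {t | InInterval (b, d) t})
    ⟨hba, had⟩ hbij φ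
  refine ⟨d, hbd, ⟨⟨fun t => if h : b ≤ t then X.map h x else 0,
    fun t => if InInterval (b, d) t then ℓ t else 0, fun h hs ht => ?_, fun h hs ht => ?_,
    fun {s t} h ht y => ?_, fun t ht => if_neg ht, fun t ht => ?_⟩⟩⟩
  · rw [dif_pos hs.1, dif_pos ht.1, map_map]
  · rw [dif_pos hs.1, map_map]
    exact (hdeath _ _).2 (not_lt.1 fun h1 => ht ⟨hs.1.trans h, h1⟩)
  · by_cases hs : InInterval (b, d) s
    · rw [if_pos hs, if_pos ht, hℓ s t h hs ht]
    · have hsb : s < b := by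
        by_contra! hbs
        exact hs ⟨hbs, (WithTop.coe_le_coe.2 h).trans_lt ht.2⟩
      have := hlt s hsb
      rw [Subsingleton.elim y 0, map_zero, map_zero, map_zero]
  · rw [dif_pos ht.1, if_pos ht, ← hφ]
    rcases le_total a t with h | h
    · rw [← X.map_map hba h, hℓ a t h ⟨hba, had⟩ ht]
    · rw [← X.map_map ht.1 h, hℓ t a h ht ⟨hba, had⟩]

end Tame

theorem isomorphic_directSum_zero {P : Type} [Preorder P] {X : PersistenceModule.{u, w₁} F P}
    (hX : X.IsTrivial) (Y : Fin 0 → PersistenceModule.{u, w₂} F P) :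
    X.Isomorphic (directSum Y) :=
  have h0 : ∀ p, Subsingleton ((directSum Y).obj p) := fun p =>
    inferInstanceAs (Subsingleton (∀ j, (Y j).obj p))
  ⟨fun p => have := hX p; have := h0 p; 0, fun _ q _ _ => (h0 q).elim _ _⟩

/-- The intervals are split off one at a time, beginning with the leftmost birth. -/
theorem Tame.exists_decomposition {X : PersistenceModule.{u, w} F ℝ} {T : Finset ℝ}
    (hT : X.Tame T) (hX : X.PointwiseFinite) :
    ∃ (n : ℕ) (I : Fin n → ℝ × WithTop ℝ), (∀ j, ((I j).1 : WithTop ℝ) < (I j).2) ∧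
      X.Isomorphic (directSum fun j => interval F (I j)) := by
  classical
  induction hk : ∑ τ ∈ T, Module.finrank F (X.obj τ) using Nat.strong_induction_on
    generalizing X with
  | _ k ih =>
  by_cases hne : (T.filter fun τ => Nontrivial (X.obj τ)).Nonempty
  · obtain ⟨b, hb, hmin⟩ := Finset.exists_min_image _ id hne
    obtain ⟨hbT, hnt⟩ := Finset.mem_filter.1 hb
    have hlt : ∀ t < b, Subsingleton (X.obj t) := fun t ht => hT.subsingleton fun τ hτ hτt =>
      not_nontrivial_iff_subsingleton.1 fun h =>
        (hmin τ (Finset.mem_filter.2 ⟨hτ, h⟩)).not_gt (hτt.trans_lt ht)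
    obtain ⟨d, hbd, ⟨S⟩⟩ := hT.exists_splitting hbT hlt hnt
    have hsum : ∑ τ ∈ T, Module.finrank F (S.complement.obj τ) < k :=
      hk ▸ Finset.sum_lt_sum (fun τ _ => S.finrank_complement_le hX τ)
        ⟨b, hbT, S.finrank_complement_lt hX ⟨le_rfl, hbd⟩⟩
    obtain ⟨n, I, hI, h⟩ :=
      ih _ hsum (S.tame_complement hT) (S.pointwiseFinite_complement hX) rfl
    exact ⟨n + 1, Fin.cons (b, d) I, fun j => Fin.cases hbd hI j, S.isomorphic_cons h⟩
  · have hX0 : X.IsTrivial := fun t => hT.subsingleton fun τ hτ _ =>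
      not_nontrivial_iff_subsingleton.1 fun h => hne ⟨τ, Finset.mem_filter.2 ⟨hτ, h⟩⟩
    exact ⟨0, Fin.elim0, fun j => j.elim0, isomorphic_directSum_zero hX0 _⟩

theorem Tame.isDiagram_dgm {X : PersistenceModule.{u, w} F ℝ} {T : Finset ℝ} (hT : X.Tame T)
    (hX : X.PointwiseFinite) : X.IsDiagram X.dgm := by
  obtain ⟨n, I, hI, h⟩ := hT.exists_decomposition hX
  refine Classical.epsilon_spec (p := X.IsDiagram)
    ⟨Finset.univ.val.map I, fun J hJ => ?_, n, I, rfl, h⟩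
  obtain ⟨j, -, rfl⟩ := Multiset.mem_map.1 hJ
  exact hI j

end PersistenceModule

/-! ## Ranks and bar counts -/

open Classical in
/-- The number of bars `[b, d)` of `D` with `b ≤ s` and `t < d`: the rank of the transition map from
`s` to `t` for a one-parameter module with diagram `D`. -/
noncomputable def barCount (D : Multiset (ℝ × WithTop ℝ)) (s t : ℝ) : ℕ :=
  D.countP fun I => I.1 ≤ s ∧ (t : WithTop ℝ) < I.2

theorem barCount_pos {D : Multiset (ℝ × WithTop ℝ)} {s t : ℝ} :
    0 < barCount D s t ↔ ∃ I ∈ D, I.1 ≤ s ∧ (t : WithTop ℝ) < I.2 :=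
  Multiset.countP_pos

theorem barCount_add (D D' : Multiset (ℝ × WithTop ℝ)) (s t : ℝ) :
    barCount (D + D') s t = barCount D s t + barCount D' s t :=
  Multiset.countP_add _ _ _

theorem barCount_offDiag (D : Multiset (ℝ × WithTop ℝ)) {s t : ℝ} (h : s ≤ t) :
    barCount (offDiag D) s t = barCount D s t := by
  classical
  unfold barCount offDiag
  rw [Multiset.countP_filter]
  refine Multiset.countP_congr rfl fun I _ => propext ⟨fun hI => hI.1, fun hI => ⟨hI, ?_⟩⟩
  exact (WithTop.coe_le_coe.2 (hI.1.trans h)).trans_lt hI.2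

theorem exists_coe_upperBound {S : Finset (WithTop ℝ)} {b : ℝ} {d : WithTop ℝ}
    (hbd : (b : WithTop ℝ) < d) (hS : ∀ x ∈ S, x < d) :
    ∃ t : ℝ, b ≤ t ∧ (t : WithTop ℝ) < d ∧ ∀ x ∈ S, x ≤ t := by
  classical
  have hlt : (insert (b : WithTop ℝ) S).max' (Finset.insert_nonempty _ _) < d :=
    (Finset.max'_lt_iff _ _).2 (Finset.forall_mem_insert _ _ _ |>.2 ⟨hbd, hS⟩)
  obtain ⟨t, ht⟩ := WithTop.ne_top_iff_exists.1 hlt.ne_top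
  have hle : ∀ x ∈ insert (b : WithTop ℝ) S, x ≤ t := fun x hx => ht ▸ Finset.le_max' _ x hx
  exact ⟨t, WithTop.coe_le_coe.1 (hle b (Finset.mem_insert_self _ _)), ht ▸ hlt,
    fun x hx => hle x (Finset.mem_insert_of_mem hx)⟩

theorem mem_of_barCount_le_of_extremal {D D' : Multiset (ℝ × WithTop ℝ)}
    (hcount : ∀ s t, s ≤ t → barCount D s t ≤ barCount D' s t) {I : ℝ × WithTop ℝ}
    (hI : (I.1 : WithTop ℝ) < I.2) (hID : I ∈ D)
    (hmin : ∀ J ∈ D', I.1 < J.1 ∨ I.1 = J.1 ∧ J.2 ≤ I.2) : I ∈ D' := by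
  classical
  by_contra hI'
  obtain ⟨t, hbt, htd, ht⟩ := exists_coe_upperBound
    (S := (D'.toFinset.filter fun J => I.1 = J.1).image Prod.snd) hI <| by
      simp only [Finset.mem_image, Finset.mem_filter, Multiset.mem_toFinset]
      rintro _ ⟨J, ⟨hJ, hIJ⟩, rfl⟩
      have hle : J.2 ≤ I.2 := (hmin J hJ).elim (fun h => absurd hIJ h.ne) And.right
      exact hle.lt_of_ne fun h => hI' ((Prod.ext hIJ h.symm : I = J) ▸ hJ)
  obtain ⟨J, hJ, hJI, htJ⟩ := barCount_pos.1
    ((barCount_pos.2 ⟨I, hID, le_rfl, htd⟩).trans_le (hcount _ _ hbt))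
  have hIJ : I.1 = J.1 := (hmin J hJ).elim (fun h => absurd hJI h.not_ge) And.left
  refine (ht J.2 ?_).not_gt htJ
  exact Finset.mem_image_of_mem _ (Finset.mem_filter.2 ⟨Multiset.mem_toFinset.2 hJ, hIJ⟩)

/-- After cancelling the common bars, a longest one among the bars with the earliest birth would
have to occur on both sides. -/
theorem eq_of_barCount_eq {D D' : Multiset (ℝ × WithTop ℝ)}
    (hD : ∀ I ∈ D, (I.1 : WithTop ℝ) < I.2) (hD' : ∀ I ∈ D', (I.1 : WithTop ℝ) < I.2)
    (h : ∀ s t, s ≤ t → barCount D s t = barCount D' s t) : D = D' := by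
  classical
  have hsub : ∀ s t, s ≤ t → barCount (D - D') s t = barCount (D' - D) s t := by
    intro s t hst
    refine add_right_cancel (b := barCount (D ∩ D') s t) ?_
    rw [← barCount_add, ← barCount_add, Multiset.sub_add_inter, Multiset.inter_comm,
      Multiset.sub_add_inter, h s t hst]
  by_contra hne
  obtain ⟨I, hI, hmin⟩ := ((D - D') + (D' - D)).toFinset.exists_min_image
    (fun I => (toLex (I.1, OrderDual.toDual I.2) : ℝ ×ₗ (WithTop ℝ)ᵒᵈ)) <| by
      rw [Multiset.toFinset_nonempty]
      intro h0
      obtain ⟨h₁, h₂⟩ := add_eq_zero.1 h0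
      exact hne ((tsub_eq_zero_iff_le.1 h₁).antisymm (tsub_eq_zero_iff_le.1 h₂))
  have hmin' : ∀ J ∈ (D - D') + (D' - D), I.1 < J.1 ∨ I.1 = J.1 ∧ J.2 ≤ I.2 := fun J hJ =>
    Prod.Lex.toLex_le_toLex.1 (hmin J (Multiset.mem_toFinset.2 hJ))
  suffices I ∈ D - D' ∧ I ∈ D' - D from
    (Multiset.mem_sub.1 this.1).asymm (Multiset.mem_sub.1 this.2)
  rcases Multiset.mem_add.1 (Multiset.mem_toFinset.1 hI) with hI | hI
  · refine ⟨hI, mem_of_barCount_le_of_extremal (fun s t hst => (hsub s t hst).le)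
      (hD I (Multiset.mem_of_le tsub_le_self hI)) hI fun J hJ =>
        hmin' J (Multiset.mem_add.2 (Or.inr hJ))⟩
  · refine ⟨mem_of_barCount_le_of_extremal (fun s t hst => (hsub s t hst).ge)
      (hD' I (Multiset.mem_of_le tsub_le_self hI)) hI fun J hJ =>
        hmin' J (Multiset.mem_add.2 (Or.inl hJ)), hI⟩

theorem finrank_range_pi {R ι : Type*} [Fintype ι] [DivisionRing R] {V W : ι → Type*}
    [∀ j, AddCommGroup (V j)] [∀ j, Module R (V j)] [∀ j, AddCommGroup (W j)]
    [∀ j, Module R (W j)] (f : ∀ j, V j →ₗ[R] W j) [∀ j, Module.Finite R (LinearMap.range (f j))] :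
    Module.finrank R (LinearMap.range (LinearMap.pi fun j => f j ∘ₗ LinearMap.proj j)) =
      ∑ j, Module.finrank R (LinearMap.range (f j)) := by
  let Φ : (∀ j, LinearMap.range (f j)) →ₗ[R] ∀ j, W j :=
    LinearMap.pi fun j => (LinearMap.range (f j)).subtype ∘ₗ LinearMap.proj j
  have hΦ : Function.Injective Φ := fun x y hxy =>
    funext fun j => Subtype.ext (congrFun hxy j)
  have hrange : LinearMap.range (LinearMap.pi fun j => f j ∘ₗ LinearMap.proj j) =
      LinearMap.range Φ := by
    refine le_antisymm ?_ ?_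
    · rintro _ ⟨x, rfl⟩
      exact ⟨fun j => ⟨f j (x j), x j, rfl⟩, rfl⟩
    · rintro _ ⟨y, rfl⟩
      choose x hx using fun j => (y j).2
      exact ⟨x, funext hx⟩
  rw [hrange, LinearMap.finrank_range_of_inj hΦ, Module.finrank_pi_fintype]

namespace PersistenceModule

variable {F : Type u} [Field F]

section Rank

variable {P : Type} [Preorder P]

theorem Isomorphic.rank_eq {M : PersistenceModule.{u, w₁} F P} {N : PersistenceModule.{u, w₂} F P}
    (h : M.Isomorphic N) {p q : P} (hpq : p ≤ q) : M.rank hpq = N.rank hpq := by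
  obtain ⟨e, he⟩ := h
  have hcomp : (e q).toLinearMap ∘ₗ M.map hpq = N.map hpq ∘ₗ (e p).toLinearMap :=
    LinearMap.ext (he p q hpq)
  have hrange := congrArg LinearMap.range hcomp
  rw [LinearMap.range_comp, LinearEquiv.range_comp] at hrange
  rw [rank, rank, ← hrange, LinearEquiv.finrank_map_eq]

theorem rank_directSum {n : ℕ} {M : Fin n → PersistenceModule.{u, w} F P}
    (hM : ∀ j, (M j).PointwiseFinite) {p q : P} (h : p ≤ q) :
    (directSum M).rank h = ∑ j, (M j).rank h :=
  have := fun j => hM j p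
  finrank_range_pi fun j => (M j).map h

end Rank

theorem pointwiseFinite_interval (I : ℝ × WithTop ℝ) : (interval F I).PointwiseFinite :=
  fun s => inferInstanceAs (Module.Finite F (intervalSpace F I s))

open Classical in
theorem rank_interval (I : ℝ × WithTop ℝ) {s t : ℝ} (h : s ≤ t) :
    (interval F I).rank h = if I.1 ≤ s ∧ (t : WithTop ℝ) < I.2 then 1 else 0 := by
  have hcoe (x : (interval F I).obj s) : ((interval F I).map h x).1 =
      (if InInterval I t then (intervalSpace F I s).subtype else 0) x := rfl
  split_ifs with hI
  · have hs : InInterval I s := ⟨hI.1, (WithTop.coe_le_coe.2 h).trans_lt hI.2⟩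
    have ht : InInterval I t := ⟨hI.1.trans h, hI.2⟩
    rw [if_pos ht] at hcoe
    let e : (interval F I).obj s := ⟨1, fun hs' => absurd hs hs'⟩
    refine finrank_eq_one ⟨_, e, rfl⟩ (fun h0 => one_ne_zero (α := F) ?_) ?_
    · exact (hcoe e).symm.trans (congrArg (fun y => y.1.1) h0)
    · rintro ⟨_, x, rfl⟩
      refine ⟨x.1, Subtype.ext (Subtype.ext ?_)⟩
      exact (congrArg (x.1 * ·) (hcoe e)).trans ((mul_one x.1).trans (hcoe x).symm)
  · refine (congrArg (fun f => Module.finrank F (LinearMap.range f))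
      (LinearMap.ext fun x => Subtype.ext ?_ : (interval F I).map h = 0)).trans
        (by rw [LinearMap.range_zero, finrank_bot])
    refine (hcoe x).trans ?_
    split_ifs with ht
    · exact x.2 fun hs => hI ⟨hs.1, ht.2⟩
    · rfl

theorem rank_directSum_interval {n : ℕ} (I : Fin n → ℝ × WithTop ℝ) {s t : ℝ} (h : s ≤ t) :
    (directSum fun j => interval F (I j)).rank h = barCount (Finset.univ.val.map I) s t := by
  classical
  rw [rank_directSum fun j => pointwiseFinite_interval (I j)]
  simp only [rank_interval, barCount, Multiset.countP_map, Finset.sum_boole, Nat.cast_id]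
  rfl

theorem Tame.rank_eq_barCount {X : PersistenceModule.{u, w} F ℝ} {T : Finset ℝ} (hT : X.Tame T)
    (hX : X.PointwiseFinite) {s t : ℝ} (h : s ≤ t) : X.rank h = barCount X.dgm s t := by
  obtain ⟨-, n, I, hI, hiso⟩ := hT.isDiagram_dgm hX
  rw [hI, hiso.rank_eq h, rank_directSum_interval]

end PersistenceModule

/-! ## Barcodes along sup-preserving functions -/

section Barcode

variable {F : Type u} [Field F] {P : Type} [SemilatticeSup P] {M : PersistenceModule.{u, w} F P}
  {S : Set P} {g g₀ : P → ℝ} {D D' : Multiset (Bar ℝ)}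

/-- The function preserves binary suprema. -/
def SupMap (g : P → ℝ) : Prop := ∀ p q, g (p ⊔ q) = max (g p) (g q)

theorem SupMap.exists_isGreatest (hg : SupMap g) (hS : S.Finite) (hS' : SupClosed S) {s : ℝ}
    (h : ∃ c ∈ S, g c ≤ s) : ∃ p, IsGreatest {c ∈ S | g c ≤ s} p := by
  have hfin : {c ∈ S | g c ≤ s}.Finite := hS.subset fun c hc => hc.1
  have hne : hfin.toFinset.Nonempty := hfin.toFinset_nonempty.2 h
  have hcl : SupClosed {c ∈ S | g c ≤ s} := fun p hp q hq =>
    ⟨hS' hp.1 hq.1, (hg p q).trans_le (max_le hp.2 hq.2)⟩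
  exact ⟨hfin.toFinset.sup' hne id, hcl.finsetSup'_mem hne fun c hc => hfin.mem_toFinset.1 hc,
    fun c hc => Finset.le_sup' id (hfin.mem_toFinset.2 hc)⟩

/-- `D` has the bar counts prescribed by the ranks of the transition maps of `M` between the
critical values in `S`, when the critical value `c` is placed at `g c`.  This makes sense even if
`g` does not come from the restriction of `M` to a line, and determines `D` up to bars of length
zero. -/
structure IsBarcode (M : PersistenceModule.{u, w} F P) (S : Set P) (g : P → ℝ)
    (D : Multiset (Bar ℝ)) : Prop where
  le : ∀ I ∈ D, (I.1 : WithTop ℝ) ≤ I.2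
  count_zero : ∀ s t, s ≤ t → (∀ c ∈ S, s < g c) → barCount D s t = 0
  count_eq : ∀ s t, s ≤ t → ∀ (p q : P) (h : p ≤ q), IsGreatest {c ∈ S | g c ≤ s} p →
    IsGreatest {c ∈ S | g c ≤ t} q → barCount D s t = M.rank h

theorem countP_lt_countP {α : Type*} {p q : α → Prop} [DecidablePred p] [DecidablePred q]
    {D : Multiset α} (hpq : ∀ x, p x → q x) {x : α} (hx : x ∈ D) (hqx : q x) (hpx : ¬p x) :
    D.countP p < D.countP q := by
  obtain ⟨D, rfl⟩ := Multiset.exists_cons_of_mem hx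
  rw [Multiset.countP_cons_of_pos _ hqx, Multiset.countP_cons_of_neg _ hpx, Nat.lt_succ_iff,
    Multiset.countP_eq_card_filter, Multiset.countP_eq_card_filter]
  exact Multiset.card_le_card (Multiset.monotone_filter_right _ fun x h => hpq x h)

theorem exists_mem_Ico_forall_le_iff {V : Set ℝ} (hV : V.Finite) {a x : ℝ} (hax : a < x)
    (hx : x ∉ V) : ∃ y ∈ Set.Ico a x, ∀ v ∈ V, v ≤ x ↔ v ≤ y := by
  obtain ⟨y, hy, hyV⟩ :=
    exists_Ioc_subset_of_mem_nhds' (hV.isClosed.isOpen_compl.mem_nhds hx) hax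
  exact ⟨y, hy, fun v hv => ⟨fun hvx => not_lt.1 fun hyv => hyV ⟨hyv, hvx⟩ hv,
    fun hvy => hvy.trans hy.2.le⟩⟩

namespace IsBarcode

theorem barCount_congr (hS : S.Finite) (hS' : SupClosed S) (hg : SupMap g)
    (hD : IsBarcode M S g D) (hD' : IsBarcode M S g D') {s t s' t' : ℝ} (hst : s ≤ t)
    (hst' : s' ≤ t') (hs : ∀ c ∈ S, g c ≤ s ↔ g c ≤ s') (ht : ∀ c ∈ S, g c ≤ t ↔ g c ≤ t') :
    barCount D s t = barCount D' s' t' := by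
  by_cases h : ∃ c ∈ S, g c ≤ s
  · obtain ⟨p, hp⟩ := hg.exists_isGreatest hS hS' h
    obtain ⟨q, hq⟩ := hg.exists_isGreatest hS hS' (s := t)
      (h.imp fun c hc => ⟨hc.1, hc.2.trans hst⟩)
    have hpq : p ≤ q := hq.2 ⟨hp.1.1, hp.1.2.trans hst⟩
    rw [hD.count_eq s t hst p q hpq hp hq]
    rw [Set.ext fun c => and_congr_right (hs c)] at hp
    rw [Set.ext fun c => and_congr_right (ht c)] at hq
    rw [hD'.count_eq s' t' hst' p q hpq hp hq]
  · push Not at h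
    rw [hD.count_zero s t hst h,
      hD'.count_zero s' t' hst' fun c hc => not_le.1 fun h' => (h c hc).not_ge ((hs c hc).2 h')]

theorem offDiag_eq (hS : S.Finite) (hS' : SupClosed S) (hg : SupMap g) (hD : IsBarcode M S g D)
    (hD' : IsBarcode M S g D') : offDiag D = offDiag D' := by
  refine eq_of_barCount_eq (fun I hI => (Multiset.mem_filter.1 hI).2)
    (fun I hI => (Multiset.mem_filter.1 hI).2) fun s t hst => ?_
  rw [barCount_offDiag _ hst, barCount_offDiag _ hst]
  exact barCount_congr hS hS' hg hD hD' hst hst (fun _ _ => Iff.rfl) fun _ _ => Iff.rfl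

theorem birth_mem (hS : S.Finite) (hS' : SupClosed S) (hg : SupMap g) (hD : IsBarcode M S g D)
    {I : Bar ℝ} (hI : I ∈ D) (hlt : (I.1 : WithTop ℝ) < I.2) : I.1 ∈ g '' S := by
  by_contra hnot
  obtain ⟨s, ⟨-, hs⟩, hle⟩ := exists_mem_Ico_forall_le_iff (hS.image g) (sub_one_lt I.1) hnot
  have hcount : barCount D s I.1 < barCount D I.1 I.1 :=
    countP_lt_countP (fun J hJ => ⟨hJ.1.trans hs.le, hJ.2⟩) hI ⟨le_rfl, hlt⟩
      fun h => h.1.not_gt hs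
  exact hcount.ne (barCount_congr hS hS' hg hD hD hs.le le_rfl
    (fun c hc => (hle _ (Set.mem_image_of_mem g hc)).symm) fun _ _ => Iff.rfl)

theorem death_mem (hS : S.Finite) (hS' : SupClosed S) (hg : SupMap g) (hD : IsBarcode M S g D)
    {b d : ℝ} (hI : (b, (d : WithTop ℝ)) ∈ D) (hbd : b < d) : d ∈ g '' S := by
  by_contra hnot
  obtain ⟨t, ⟨hbt, ht⟩, hle⟩ := exists_mem_Ico_forall_le_iff (hS.image g) hbd hnot
  have hcount : barCount D b d < barCount D b t :=
    countP_lt_countP (fun J hJ => ⟨hJ.1, (WithTop.coe_lt_coe.2 ht).trans hJ.2⟩) hI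
      ⟨le_rfl, WithTop.coe_lt_coe.2 ht⟩ fun h => lt_irrefl _ h.2
  exact hcount.ne (barCount_congr hS hS' hg hD hD hbd.le hbt (fun _ _ => Iff.rfl)
    fun c hc => hle _ (Set.mem_image_of_mem g hc))

theorem exists_lift (hS : S.Finite) (hS' : SupClosed S) (hg : SupMap g) (hD : IsBarcode M S g D)
    (hlt : ∀ I ∈ D, (I.1 : WithTop ℝ) < I.2) :
    ∃ A : Multiset (Bar P), EndpointsIn A S ∧ A.map (evalBar g) = D := by
  have hbar : ∀ I ∈ D, ∃ x : Bar P, (x.1 ∈ S ∧ x.2 ∈ extend S) ∧ evalBar g x = I := by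
    rintro ⟨b, d⟩ hI
    obtain ⟨p, hp, rfl⟩ := hD.birth_mem hS hS' hg hI (hlt _ hI)
    induction d using WithTop.recTopCoe with
    | top => exact ⟨(p, ⊤), ⟨hp, Set.mem_insert _ _⟩, rfl⟩
    | coe d =>
      obtain ⟨q, hq, rfl⟩ := hD.death_mem hS hS' hg hI (WithTop.coe_lt_coe.1 (hlt _ hI))
      exact ⟨(p, q), ⟨hp, Set.mem_insert_of_mem _ (Set.mem_image_of_mem _ hq)⟩, rfl⟩
  choose x hx hxI using hbar
  refine ⟨D.attach.map fun I : {I // I ∈ D} => x I I.2, fun y hy => ?_, ?_⟩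
  · obtain ⟨I, -, rfl⟩ := Multiset.mem_map.1 hy
    exact hx I I.2
  · rw [Multiset.map_map]
    exact (Multiset.map_congr rfl fun (I : {I // I ∈ D}) _ => hxI I.1 I.2).trans D.attach_map_val

end IsBarcode

theorem OrderCompat.exists_level {α : Type*} {S : Set α} {g₀ g : α → ℝ} (hS : S.Finite)
    (h : OrderCompat S g₀ g) {s : ℝ} (hs : ∃ c ∈ S, g c ≤ s) :
    ∃ c₁ ∈ S, g c₁ ≤ s ∧ ∀ c ∈ S, g c ≤ s ↔ g₀ c ≤ g₀ c₁ := by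
  have hfin : {c ∈ S | g c ≤ s}.Finite := hS.subset fun c hc => hc.1
  obtain ⟨c₁, hc₁, hmax⟩ := Set.exists_max_image _ g₀ hfin hs
  exact ⟨c₁, hc₁.1, hc₁.2, fun c hc => ⟨fun h' => hmax c ⟨hc, h'⟩,
    fun h' => (h c hc c₁ hc₁.1 h').trans hc₁.2⟩⟩

theorem barCount_map_evalBar_congr {α : Type*} {S : Set α} {g g₀ : α → ℝ}
    {A : Multiset (Bar α)} (hA : EndpointsIn A S) {s t s' t' : ℝ}
    (hs : ∀ c ∈ S, g c ≤ s ↔ g₀ c ≤ s') (ht : ∀ c ∈ S, g c ≤ t ↔ g₀ c ≤ t') :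
    barCount (A.map (evalBar g)) s t = barCount (A.map (evalBar g₀)) s' t' := by
  unfold barCount
  rw [Multiset.countP_map, Multiset.countP_map]
  congr 1
  refine Multiset.filter_congr fun x hx => and_congr (hs _ (hA x hx).1) ?_
  obtain ⟨b, d⟩ := x
  rcases (hA _ hx).2 with rfl | ⟨d, hd, rfl⟩
  · exact iff_of_true (WithTop.coe_lt_top t) (WithTop.coe_lt_top t')
  · simpa only [evalBar, WithTop.map_coe, WithTop.coe_lt_coe, not_le] using not_congr (ht d hd)

theorem IsBarcode.map_evalBar (hS : S.Finite) {A : Multiset (Bar P)} (hA : EndpointsIn A S)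
    (h : IsBarcode M S g₀ (A.map (evalBar g₀))) (hg : OrderCompat S g₀ g) :
    IsBarcode M S g (A.map (evalBar g)) := by
  refine ⟨fun I hI => ?_, fun s t _ hs => ?_, fun s t hst p q hpq hp hq => ?_⟩
  · obtain ⟨⟨b, d⟩, hx, rfl⟩ := Multiset.mem_map.1 hI
    have hle := h.le _ (Multiset.mem_map_of_mem _ hx)
    obtain ⟨hb, rfl | ⟨d, hd, rfl⟩⟩ := hA _ hx
    · exact le_top
    · exact WithTop.coe_le_coe.2 (hg b hb d hd (WithTop.coe_le_coe.1 hle))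
  · by_contra hne
    obtain ⟨I, hI, hIs, -⟩ := barCount_pos.1 (Nat.pos_of_ne_zero hne)
    obtain ⟨x, hx, rfl⟩ := Multiset.mem_map.1 hI
    exact hIs.not_gt (hs _ (hA x hx).1)
  · obtain ⟨c₁, hc₁, hc₁s, hs⟩ := hg.exists_level hS ⟨p, hp.1⟩
    obtain ⟨c₂, hc₂, -, ht⟩ := hg.exists_level hS ⟨q, hq.1⟩
    rw [Set.ext fun c => and_congr_right (hs c)] at hp
    rw [Set.ext fun c => and_congr_right (ht c)] at hq
    rw [barCount_map_evalBar_congr hA hs ht]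
    exact h.count_eq _ _ ((ht c₁ hc₁).1 (hc₁s.trans hst)) p q hpq hp hq

end Barcode

/-! ## Restriction to a line -/

section Restrict

variable {F : Type u} [Field F]

namespace PersistenceModule

variable {P : Type} [Preorder P] {X : PersistenceModule.{u, w} F P}

theorem rank_refl (X : PersistenceModule.{u, w} F P) (p : P) :
    X.rank (le_refl p) = Module.finrank F (X.obj p) := by
  rw [rank, X.map_refl, LinearMap.range_id, finrank_top]

theorem PointwiseFinite.subsingleton (hX : X.PointwiseFinite) {p : P}
    (h : X.rank (le_refl p) = 0) : Subsingleton (X.obj p) := by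
  have := hX p
  exact Module.finrank_zero_iff.1 ((X.rank_refl p).symm.trans h)

theorem PointwiseFinite.bijective_map (hX : X.PointwiseFinite) {p q : P} (h : p ≤ q)
    (hp : X.rank h = X.rank (le_refl p)) (hq : X.rank h = X.rank (le_refl q)) :
    Function.Bijective (X.map h) := by
  have := hX p
  have := hX q
  have hsurj : Function.Surjective (X.map h) :=
    LinearMap.range_eq_top.1 (Submodule.eq_top_of_finrank_eq (hq.trans (X.rank_refl q)))
  have hdim : Module.finrank F (X.obj p) = Module.finrank F (X.obj q) := by
    rw [← X.rank_refl, ← X.rank_refl, ← hp, hq]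
  exact ⟨(LinearMap.injective_iff_surjective_of_finrank_eq_finrank hdim).2 hsurj, hsurj⟩

end PersistenceModule

namespace PosLine

theorem le_pt_iff (L : PosLine) (c : Plane) (s : ℝ) : c ≤ L.pt s ↔ L.pushParam c ≤ s := by
  simp only [Pi.le_def, Fin.forall_fin_two, pushParam, max_le_iff, div_le_iff₀ (L.m_pos _), pt,
    Pi.add_apply, Pi.smul_apply, smul_eq_mul, sub_le_iff_le_add]

theorem setOf_le_pt (L : PosLine) (S : Set Plane) (s : ℝ) :
    {c ∈ S | c ≤ L.pt s} = {c ∈ S | L.pushParam c ≤ s} :=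
  Set.ext fun c => and_congr_right fun _ => L.le_pt_iff c s

theorem supMap_pushParam (L : PosLine) : SupMap L.pushParam := by
  intro p q
  refine eq_of_forall_ge_iff fun s => ?_
  rw [← L.le_pt_iff, sup_le_iff, L.le_pt_iff, L.le_pt_iff, max_le_iff]

theorem weight_pos (L : PosLine) : 0 < L.weight := lt_min (L.m_pos 0) (L.m_pos 1)

end PosLine

namespace PropertyP

variable {M : PersistenceModule.{u, w} F Plane} {C : Set Plane}

theorem rank_restrict_eq_zero (hC : PropertyP M C) (L : PosLine) {s t : ℝ} (h : s ≤ t)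
    (hs : ∀ c ∈ supClosure C, s < L.pushParam c) : (M.restrict L).rank h = 0 := by
  refine (hC.2 (L.pt s) (L.pt t) (L.pt_mono h)).2 ?_
  rw [L.setOf_le_pt]
  exact Set.eq_empty_of_forall_notMem fun c hc => (hs c hc.1).not_ge hc.2

theorem rank_restrict_eq (hC : PropertyP M C) (L : PosLine) {s t : ℝ} (h : s ≤ t) {p q : Plane}
    (hpq : p ≤ q) (hp : IsGreatest {c ∈ supClosure C | L.pushParam c ≤ s} p)
    (hq : IsGreatest {c ∈ supClosure C | L.pushParam c ≤ t} q) :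
    (M.restrict L).rank h = M.rank hpq := by
  rw [← L.setOf_le_pt] at hp hq
  exact (hC.2 (L.pt s) (L.pt t) (L.pt_mono h)).1 p q hpq hp hq

theorem tame_restrict (hC : PropertyP M C) (hM : M.PointwiseFinite) (L : PosLine) :
    (M.restrict L).Tame (hC.1.supClosure.toFinset.image L.pushParam) := by
  have hX : (M.restrict L).PointwiseFinite := fun s => hM _
  have hzero : ∀ s, (∀ c ∈ supClosure C, s < L.pushParam c) →
      Subsingleton ((M.restrict L).obj s) :=
    fun s hs => hX.subsingleton (hC.rank_restrict_eq_zero L le_rfl hs)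
  simp only [PersistenceModule.Tame, Finset.forall_mem_image, Set.Finite.mem_toFinset]
  refine ⟨fun s t h hst => ?_, hzero⟩
  by_cases hne : ∃ c ∈ supClosure C, L.pushParam c ≤ s
  · obtain ⟨p, hps⟩ :=
      L.supMap_pushParam.exists_isGreatest hC.1.supClosure supClosed_supClosure hne
    have hpt : IsGreatest {c ∈ supClosure C | L.pushParam c ≤ t} p :=
      ⟨⟨hps.1.1, hps.1.2.trans h⟩, fun c hc => hps.2 ⟨hc.1, hst hc.1 hc.2⟩⟩
    have hrank := hC.rank_restrict_eq L h le_rfl hps hpt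
    exact hX.bijective_map h (hrank.trans (hC.rank_restrict_eq L le_rfl le_rfl hps hps).symm)
      (hrank.trans (hC.rank_restrict_eq L le_rfl le_rfl hpt hpt).symm)
  · push Not at hne
    have := hzero s hne
    have := hzero t fun c hc => lt_of_not_ge fun hct => (hne c hc).not_ge (hst hc hct)
    exact ⟨Function.injective_of_subsingleton _, Function.surjective_to_subsingleton _⟩

theorem isBarcode_dgm (hC : PropertyP M C) (hM : M.PointwiseFinite) (L : PosLine) :
    IsBarcode M (supClosure C) L.pushParam (M.restrict L).dgm := by
  have hX : (M.restrict L).PointwiseFinite := fun s => hM _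
  have hT := hC.tame_restrict hM L
  refine ⟨fun I hI => ((hT.isDiagram_dgm hX).1 I hI).le, fun s t hst hs => ?_,
    fun s t hst p q hpq hp hq => ?_⟩
  · rw [← hT.rank_eq_barCount hX hst, hC.rank_restrict_eq_zero L hst hs]
  · rw [← hT.rank_eq_barCount hX hst, hC.rank_restrict_eq L hst hpq hp hq]

/-- The bars of a restriction end at critical values, and the same bars with symbolic end points
describe the module along every placement that only collapses critical values. -/
theorem exists_symbolic_dgm (hC : PropertyP M C) (hM : M.PointwiseFinite) (L : PosLine) :
    ∃ A : Multiset (Bar Plane), EndpointsIn A (supClosure C) ∧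
      A.map (evalBar L.pushParam) = (M.restrict L).dgm ∧
      ∀ g, OrderCompat (supClosure C) L.pushParam g →
        IsBarcode M (supClosure C) g (A.map (evalBar g)) := by
  have hD := hC.isBarcode_dgm hM L
  obtain ⟨A, hA, hAD⟩ := hD.exists_lift hC.1.supClosure supClosed_supClosure L.supMap_pushParam
    ((hC.tame_restrict hM L).isDiagram_dgm fun s => hM _).1
  rw [← hAD] at hD
  exact ⟨A, hA, hAD, fun g hg => hD.map_evalBar hC.1.supClosure hA hg⟩

end PropertyP

end Restrict

/-! ## The bottleneck distance along a placement of the critical values -/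

section Compat

variable {CM CN : Set Plane} {g₀ g : Plane → ℝ}

/-- The placement `g` satisfies the weak inequalities that hold for `g₀`, between critical values
of the same module and between the terms for the bottleneck distance. -/
structure Compat (CM CN : Set Plane) (g₀ g : Plane → ℝ) : Prop where
  left : OrderCompat (supClosure CM) g₀ g
  right : OrderCompat (supClosure CN) g₀ g
  terms : OrderCompat (costTerms (supClosure CM ∪ supClosure CN)) (termValue g₀) (termValue g)

/-- The function is, up to a constant, the parameter of the push onto the line, scaled by the
weight of the line. -/
def PosLine.IsWeightedParam (L : PosLine) (g : Plane → ℝ) : Prop :=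
  ∃ β, ∀ u, g u = L.weight * L.pushParam u + β

theorem PosLine.IsWeightedParam.orderCompat {L : PosLine} (hg : L.IsWeightedParam g)
    {S : Set Plane} (h : OrderCompat S g₀ L.pushParam) : OrderCompat S g₀ g := by
  obtain ⟨β, hβ⟩ := hg
  rw [show g = (fun x => L.weight * x + β) ∘ L.pushParam from funext hβ]
  exact h.monotone_comp fun x y hxy =>
    add_le_add_left (mul_le_mul_of_nonneg_left hxy L.weight_pos.le) β

theorem PosLine.IsWeightedParam.supMap {L : PosLine} (hg : L.IsWeightedParam g) : SupMap g := by
  obtain ⟨β, hβ⟩ := hg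
  intro p q
  rw [hβ, hβ, hβ, L.supMap_pushParam, mul_max_of_nonneg _ _ L.weight_pos.le, max_add_add_right]

theorem Compat.weighted {L : PosLine} (h : Compat CM CN g₀ L.pushParam)
    (hg : L.IsWeightedParam g) : Compat CM CN g₀ g := by
  refine ⟨hg.orderCompat h.left, hg.orderCompat h.right, ?_⟩
  obtain ⟨β, hβ⟩ := hg
  rw [funext (termValue_affine L.weight_pos hβ)]
  exact h.terms.monotone_comp (φ := (ENNReal.ofReal L.weight * ·)) fun _ _ h => mul_le_mul_right h _

theorem Compat.of_tendsto {ι : Type*} {l : Filter ι} [l.NeBot] {G : ι → Plane → ℝ}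
    (h : ∀ᶠ i in l, Compat CM CN g₀ (G i)) (hG : ∀ u, Tendsto (fun i => G i u) l (𝓝 (g u))) :
    Compat CM CN g₀ g where
  left := .of_tendsto (h.mono fun _ hi => hi.left) fun u _ => hG u
  right := .of_tendsto (h.mono fun _ hi => hi.right) fun u _ => hG u
  terms := .of_tendsto (h.mono fun _ hi => hi.terms) fun _ hx =>
    tendsto_termValue (fun u _ => hG u) hx

theorem Compat.exists_eventually (hCM : CM.Finite) (hCN : CN.Finite) {ι : Type*}
    (U : Ultrafilter ι) (G : ι → Plane → ℝ) : ∃ i, ∀ᶠ k in U, Compat CM CN (G i) (G k) := by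
  have hterms := costTerms_finite (hCM.supClosure.union hCN.supClosure)
  obtain ⟨i, h, h', h''⟩ := ((OrderCompat.exists_eventually hCM.supClosure U G).and
    ((OrderCompat.exists_eventually hCN.supClosure U G).and
      (OrderCompat.exists_eventually hterms U fun k => termValue (G k)))).exists
  refine ⟨i, ?_⟩
  filter_upwards [h, h', h''] with k hk hk' hk'' using ⟨hk, hk', hk''⟩

theorem orderCompat_termValue {α : Type*} {K : Set α} {f f' : α → ℝ}
    (h : ∀ u ∈ K, ∀ v ∈ K, ∀ x ∈ K, ∀ y ∈ K, ∀ k ∈ ({1, 2} : Set ℕ), ∀ l ∈ ({1, 2} : Set ℕ),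
      |f u - f v| / k ≤ |f x - f y| / l → |f' u - f' v| / k ≤ |f' x - f' y| / l) :
    OrderCompat (costTerms K) (termValue f) (termValue f') := by
  rintro ⟨u, v, k⟩ ⟨hu, hv, hk⟩ ⟨x, y, l⟩ ⟨hx, hy, hl⟩ hle
  obtain rfl | ⟨u, hu, rfl⟩ := hu <;> obtain rfl | ⟨v, hv, rfl⟩ := hv <;>
    obtain rfl | ⟨x, hx, rfl⟩ := hx <;> obtain rfl | ⟨y, hy, rfl⟩ := hy <;>
    simp only [termValue_top_top, termValue_coe_top, termValue_top_coe, le_refl, le_top, zero_le,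
      top_le_iff, ENNReal.zero_ne_top, termValue_coe_coe _ _ _ (pos_of_mem_one_two hk),
      termValue_coe_coe _ _ _ (pos_of_mem_one_two hl), ENNReal.ofReal_ne_top] at hle ⊢
  · have h0 := h u hu v hv u hu u hu k hk 1 (.inl rfl)
    simp only [sub_self, abs_zero, zero_div] at h0
    exact (ENNReal.ofReal_of_nonpos (h0 (ENNReal.ofReal_eq_zero.1 (le_bot_iff.1 hle)))).le
  · exact ENNReal.ofReal_le_ofReal (h u hu v hv x hx y hy k hk l hl
      ((ENNReal.ofReal_le_ofReal_iff (by positivity)).1 hle))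

theorem nonpos_of_sign_eq {x y : ℝ} (h : SignType.sign x = SignType.sign y) (hx : x ≤ 0) :
    y ≤ 0 := by
  rw [← not_lt, ← sign_eq_one_iff] at hx ⊢
  exact h ▸ hx

theorem PropertyQ.pushParam_le {K : Set Plane} {Ω : Set ProjPlane} (hΩ : PropertyQ K Ω)
    {L₀ L : PosLine} (hL : PosLine.Equivalent (proper '' K ∪ Ω) L₀ L) {u v x y : Plane}
    (hu : u ∈ K) (hv : v ∈ K) (hx : x ∈ K) (hy : y ∈ K) {k l : ℕ} (hk : k ∈ ({1, 2} : Set ℕ))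
    (hl : l ∈ ({1, 2} : Set ℕ))
    (h : |L₀.pushParam u - L₀.pushParam v| / k ≤ |L₀.pushParam x - L₀.pushParam y| / l) :
    |L.pushParam u - L.pushParam v| / k ≤ |L.pushParam x - L.pushParam y| / l := by
  have hcast : ∀ {k : ℕ}, k ∈ ({1, 2} : Set ℕ) → (k : ℝ) ∈ ({1, 2} : Set ℝ) := by
    rintro k (rfl | rfl) <;> simp
  exact sub_nonpos.1 (nonpos_of_sign_eq
    (hΩ.2 u hu v hv x hx y hy k (hcast hk) l (hcast hl) L₀ L hL) (sub_nonpos.2 h))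

theorem compat_of_equivalent {Ω : Set ProjPlane}
    (hΩ : PropertyQ (supClosure CM ∪ supClosure CN) Ω) {L₀ L : PosLine}
    (hL : PosLine.Equivalent (proper '' (supClosure CM ∪ supClosure CN) ∪ Ω) L₀ L) :
    Compat CM CN L₀.pushParam L.pushParam := by
  -- `p c ≤ p c'` means that `|p (c ⊔ c') - p c'|` vanishes.
  have hord : ∀ C, supClosure C ⊆ supClosure CM ∪ supClosure CN →
      OrderCompat (supClosure C) L₀.pushParam L.pushParam := by
    intro C hC c hc c' hc' hle
    have h0 := hΩ.pushParam_le hL (hC (supClosed_supClosure hc hc')) (hC hc') (hC hc) (hC hc)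
      (.inl rfl) (.inl rfl)
    simp only [L₀.supMap_pushParam c c', L.supMap_pushParam c c', max_eq_right hle, sub_self,
      abs_zero, Nat.cast_one, div_one, le_refl, true_implies, abs_nonpos_iff, sub_eq_zero,
      max_eq_right_iff] at h0
    exact h0
  exact ⟨hord CM Set.subset_union_left, hord CN Set.subset_union_right,
    orderCompat_termValue fun u hu v hv x hx y hy k hk l hl => hΩ.pushParam_le hL hu hv hx hy hk hl⟩

end Compat

section Cost

variable {F : Type u} [Field F] {M : PersistenceModule.{u, w₁} F Plane}
  {N : PersistenceModule.{u, w₂} F Plane} {CM CN : Set Plane} {g : Plane → ℝ} {κ κ' : ℝ≥0∞}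

/-- `κ` is the bottleneck distance of the barcodes of `M` and `N` when the critical values are
placed by `g`. -/
def CostAt (M : PersistenceModule.{u, w₁} F Plane) (N : PersistenceModule.{u, w₂} F Plane)
    (CM CN : Set Plane) (g : Plane → ℝ) (κ : ℝ≥0∞) : Prop :=
  ∃ D D', IsBarcode M (supClosure CM) g D ∧ IsBarcode N (supClosure CN) g D' ∧
    bottleneck D D' = κ

theorem CostAt.unique (hCM : CM.Finite) (hCN : CN.Finite) (hg : SupMap g)
    (h : CostAt M N CM CN g κ) (h' : CostAt M N CM CN g κ') : κ = κ' := by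
  obtain ⟨D, E, hD, hE, rfl⟩ := h
  obtain ⟨D', E', hD', hE', rfl⟩ := h'
  exact bottleneck_congr_offDiag hD.le hD'.le hE.le hE'.le
    (hD.offDiag_eq hCM.supClosure supClosed_supClosure hg hD')
    (hE.offDiag_eq hCN.supClosure supClosed_supClosure hg hE')

variable (hM : M.PointwiseFinite) (hN : N.PointwiseFinite) (hCM : PropertyP M CM)
  (hCN : PropertyP N CN)
include hM hN hCM hCN

theorem costAt_weightedDist {L : PosLine} (hg : L.IsWeightedParam g) :
    CostAt M N CM CN g (weightedDist M N L) := by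
  obtain ⟨A, -, hAD, hA⟩ := hCM.exists_symbolic_dgm hM L
  obtain ⟨B, -, hBD, hB⟩ := hCN.exists_symbolic_dgm hN L
  refine ⟨_, _, hA g (hg.orderCompat (.refl _ _)), hB g (hg.orderCompat (.refl _ _)), ?_⟩
  obtain ⟨β, hβ⟩ := hg
  rw [bottleneck_affine A B L.weight_pos hβ, hAD, hBD, weightedDist]

theorem exists_term_costAt (L : PosLine) :
    ∃ y ∈ costTerms (supClosure CM ∪ supClosure CN), ∀ g, Compat CM CN L.pushParam g →
      CostAt M N CM CN g (termValue g y) := by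
  obtain ⟨A, hAK, -, hA⟩ := hCM.exists_symbolic_dgm hM L
  obtain ⟨B, hBK, -, hB⟩ := hCN.exists_symbolic_dgm hN L
  obtain ⟨y, hy, h⟩ := exists_term_bottleneck (hAK.mono Set.subset_union_left)
    (hBK.mono Set.subset_union_right) L.pushParam
  exact ⟨y, hy, fun g hg => ⟨_, _, hA g hg.left, hB g hg.right, h g hg.terms⟩⟩

/-- Along an ultrafilter, the weighted distances are eventually given by a single term. -/
theorem tendsto_weightedDist {l : Filter PosLine} {G : PosLine → Plane → ℝ} (hg : SupMap g)
    (hG : ∀ᶠ L in l, L.IsWeightedParam (G L)) (hlim : ∀ u, Tendsto (fun L => G L u) l (𝓝 (g u)))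
    (hκ : CostAt M N CM CN g κ) : Tendsto (weightedDist M N) l (𝓝 κ) := by
  rw [tendsto_iff_ultrafilter]
  intro U hU
  obtain ⟨L₁, hL₁⟩ := Compat.exists_eventually hCM.1 hCN.1 U PosLine.pushParam
  obtain ⟨y, hy, hcost⟩ := exists_term_costAt hM hN hCM hCN L₁
  have hcompat : ∀ᶠ L in U, Compat CM CN L₁.pushParam (G L) := by
    filter_upwards [hL₁, hU hG] with L hL hGL using hL.weighted hGL
  have hlimU : ∀ u, Tendsto (fun L => G L u) U (𝓝 (g u)) := fun u => (hlim u).mono_left hU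
  rw [hκ.unique hCM.1 hCN.1 hg (hcost g (.of_tendsto hcompat hlimU))]
  refine (tendsto_termValue (fun u _ => hlimU u) hy).congr' ?_
  filter_upwards [hcompat, hU hG] with L hL hGL
  exact (hcost (G L) hL).unique hCM.1 hCN.1 hGL.supMap (costAt_weightedDist hM hN hCM hCN hGL)

end Cost

/-! ## Positions of steep lines -/

section Projective

variable {i j : Fin 2}

theorem forall_fin_two_of_ne (hij : i ≠ j) {P : Fin 2 → Prop} : (∀ k, P k) ↔ P i ∧ P j := by
  refine ⟨fun h => ⟨h i, h j⟩, fun h k => ?_⟩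
  obtain rfl | rfl : k = i ∨ k = j := by omega
  exacts [h.1, h.2]

theorem apply_zero_one_eq {α : Type*} {f : Fin 2 → Fin 2 → α} (hf : ∀ k l, f k l = f l k)
    (hij : i ≠ j) : f 0 1 = f i j := by
  obtain ⟨rfl, rfl⟩ | ⟨rfl, rfl⟩ : i = 0 ∧ j = 1 ∨ i = 1 ∧ j = 0 := by omega
  exacts [rfl, hf 0 1]

theorem proper_injective : Function.Injective proper := by
  intro p q h
  obtain ⟨a, ha⟩ := (Projectivization.mk_eq_mk_iff' ℝ _ _ _ _).1 h
  obtain rfl : a = 1 := by simpa using congrFun ha 0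
  exact funext (Fin.forall_fin_two.2
    ⟨by simpa using (congrFun ha 1).symm, by simpa using (congrFun ha 2).symm⟩)

theorem proper_ne_atInfinity (u v : Plane) (hv : v ≠ 0) : proper u ≠ atInfinity v hv := by
  intro h
  obtain ⟨a, ha⟩ := (Projectivization.mk_eq_mk_iff' ℝ _ _ _ _).1 h
  simpa using congrFun ha 0

theorem atInfinity_eq_iff {v w : Plane} (hv : v ≠ 0) (hw : w ≠ 0) :
    atInfinity v hv = atInfinity w hw ↔ ∃ a : ℝ, a • w = v := by
  unfold atInfinity
  rw [Projectivization.mk_eq_mk_iff']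
  simp [funext_iff, Fin.forall_fin_succ]

/-- The point at infinity of the lines `x i = ν * x j + c`. -/
noncomputable def slopePoint (hij : i ≠ j) (ν : ℝ) : ProjPlane :=
  atInfinity (Function.update 1 i ν) fun h => by simpa [hij.symm] using congrFun h j

theorem slopePoint_injective (hij : i ≠ j) : Function.Injective (slopePoint hij) := by
  intro ν ν' h
  obtain ⟨t, ht⟩ := (atInfinity_eq_iff _ _).1 h
  obtain rfl : t = 1 := by simpa [hij.symm] using congrFun ht j
  simpa using (congrFun ht i).symm

theorem slopePoint_one (hij : i ≠ j) : slopePoint hij 1 = diagonalPoint := by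
  simp only [slopePoint, diagonalPoint, show Function.update (1 : Plane) i 1 = fun _ => 1 from
    Function.update_eq_self i 1]

theorem atInfinity_eq_slopePoint (hij : i ≠ j) {v : Plane} (hv : v ≠ 0) (hj : v j ≠ 0) :
    atInfinity v hv = slopePoint hij (v i / v j) := by
  refine (atInfinity_eq_iff _ _).2 ⟨v j, funext ((forall_fin_two_of_ne hij).2 ⟨?_, ?_⟩)⟩
  · simp [mul_div_cancel₀ _ hj]
  · simp [hij.symm]

theorem le_of_mem_openFace {A : Set (Fin 2)} {u x : Plane} (hx : x ∈ openFace A u) : u ≤ x :=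
  fun k => (em (k ∈ A)).elim (fun hk => ((hx k).1 hk).ge) fun hk => ((hx k).2 hk).le

theorem smul_mem_openFace {A : Set (Fin 2)} {u x : Plane} {b : ℝ} (hb : 0 < b)
    (hx : x ∈ openFace A u) : b • x ∈ openFace A (b • u) :=
  fun k => ⟨fun hk => congrArg (b * ·) ((hx k).1 hk),
    fun hk => mul_lt_mul_of_pos_left ((hx k).2 hk) hb⟩

/-- The line `x i = μ * x j + c`. -/
def obliqueLine (i j : Fin 2) (μ c : ℝ) : Set Plane := {x | x i = μ * x j + c}

theorem obliqueLine_swap {μ : ℝ} (hμ : μ ≠ 0) (i j : Fin 2) (c : ℝ) :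
    obliqueLine j i μ⁻¹ (-(μ⁻¹ * c)) = obliqueLine i j μ c := by
  ext x
  simp only [obliqueLine, Set.mem_ofPred_eq, ← mul_neg, ← mul_add, eq_inv_mul_iff_mul_eq₀ hμ]
  exact ⟨fun h => by linarith, fun h => by linarith⟩

theorem obliqueLine_inter_openFace_nonempty_of_right (hij : i ≠ j) {μ c : ℝ} (hμ : 0 < μ)
    {u : Plane} (hu : μ * u j + c < u i) {A : Set (Fin 2)} (hA : A.Nonempty) :
    (obliqueLine i j μ c ∩ openFace A u).Nonempty ↔ i ∈ A ∧ j ∉ A := by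
  constructor
  · rintro ⟨x, hx : x i = μ * x j + c, hxA⟩
    have hj : j ∉ A := by
      intro hj
      have hui := le_of_mem_openFace hxA i
      rw [hx, (hxA j).1 hj] at hui
      exact hu.not_ge hui
    exact ⟨by_contra fun hi => hA.ne_empty
      (Set.eq_empty_of_forall_notMem ((forall_fin_two_of_ne hij).2 ⟨hi, hj⟩)), hj⟩
  · rintro ⟨hi, hj⟩
    refine ⟨Function.update u j ((u i - c) / μ), ?_, (forall_fin_two_of_ne hij).2 ?_⟩
    · simp only [obliqueLine, Set.mem_ofPred_eq, Function.update_of_ne hij, Function.update_self]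
      field_simp
      ring
    · rw [Function.update_of_ne hij, Function.update_self, lt_div_iff₀ hμ]
      exact ⟨⟨fun _ => rfl, absurd hi⟩, fun h => absurd h hj, fun _ => by linarith⟩

theorem obliqueLine_inter_openFace_nonempty_of_left (hij : i ≠ j) {μ c : ℝ} (hμ : 0 < μ)
    {u : Plane} (hu : u i < μ * u j + c) {A : Set (Fin 2)} (hA : A.Nonempty) :
    (obliqueLine i j μ c ∩ openFace A u).Nonempty ↔ j ∈ A ∧ i ∉ A := by
  rw [← obliqueLine_swap hμ.ne']
  refine obliqueLine_inter_openFace_nonempty_of_right hij.symm (inv_pos.2 hμ) ?_ hA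
  rw [← mul_neg, ← mul_add, inv_mul_lt_iff₀ hμ]
  linarith

namespace PosLine

/-- The position of a line `x i = μ * x j + c` is measured by `c`. -/
def offset (L : PosLine) (i j : Fin 2) : ℝ := L.b i - L.m i * L.b j

theorem range_smul_add_eq_obliqueLine (hij : i ≠ j) {m : Plane} (hm : m j = 1) (b : Plane) :
    (Set.range fun s : ℝ => s • m + b) = obliqueLine i j (m i) (b i - m i * b j) := by
  ext x
  simp only [obliqueLine, Set.mem_range, Set.mem_ofPred_eq, funext_iff, forall_fin_two_of_ne hij,
    Pi.add_apply, Pi.smul_apply, smul_eq_mul, hm, mul_one]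
  refine ⟨?_, fun hx => ⟨x j - b j, by rw [hx]; ring, by ring⟩⟩
  rintro ⟨s, hi, hj⟩
  rw [← hi, ← hj]
  ring

theorem carrier_eq_obliqueLine (hij : i ≠ j) {L : PosLine} (hm : L.m j = 1) :
    L.carrier = obliqueLine i j (L.m i) (L.offset i j) :=
  range_smul_add_eq_obliqueLine hij hm L.b

theorem range_smul_eq_obliqueLine (hij : i ≠ j) {L : PosLine} (hm : L.m j = 1) :
    (Set.range fun t : ℝ => t • L.m) = obliqueLine i j (L.m i) 0 := by
  simpa using range_smul_add_eq_obliqueLine hij hm 0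

theorem inter_projFace_proper_nonempty (L : PosLine) (A : Set (Fin 2)) (u : Plane) :
    (L.projCarrier ∩ projFace A (proper u)).Nonempty ↔ (L.carrier ∩ openFace A u).Nonempty := by
  constructor
  · rintro ⟨_, hq, ⟨u', x, hu, rfl, hx⟩ | ⟨v, x, hv, -, -, hu, -⟩⟩
    · obtain rfl := proper_injective hu
      rcases hq with hq | hq
      · exact ⟨x, (proper_injective.mem_set_image).1 hq, hx⟩
      · exact absurd hq (proper_ne_atInfinity _ _ _)
    · exact absurd hu (proper_ne_atInfinity _ _ _)
  · rintro ⟨x, hxL, hx⟩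
    exact ⟨proper x, .inl (Set.mem_image_of_mem _ hxL), .inl ⟨u, x, rfl, rfl, hx⟩⟩

theorem inter_projFace_atInfinity_nonempty (L : PosLine) (A : Set (Fin 2)) {v : Plane}
    (hv : v ≠ 0) (hpos : ∀ k, 0 < v k) :
    (L.projCarrier ∩ projFace A (atInfinity v hv)).Nonempty ↔
      ((Set.range fun t : ℝ => t • L.m) ∩ openFace A v).Nonempty := by
  constructor
  · rintro ⟨_, hq, ⟨u', x, hu, -, -⟩ | ⟨v', x, hv', hx0, hpos', hvv, rfl, hx⟩⟩
    · exact absurd hu.symm (proper_ne_atInfinity _ _ _)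
    · rcases hq with ⟨y, -, hy⟩ | hq
      · exact absurd hy (proper_ne_atInfinity _ _ _)
      · obtain ⟨a, rfl⟩ := (atInfinity_eq_iff _ _).1 hq
        obtain ⟨b, rfl⟩ := (atInfinity_eq_iff _ _).1 hvv
        have hb : 0 < b := pos_of_mul_pos_left (hpos 0) (hpos' 0).le
        exact ⟨b • a • L.m, ⟨b * a, mul_smul b a L.m⟩, smul_mem_openFace hb hx⟩
  · rintro ⟨_, ⟨t, rfl⟩, ht⟩
    have ht0 : t • L.m ≠ 0 := fun h0 =>
      ((hpos 0).trans_le (le_of_mem_openFace ht 0)).ne' (congrFun h0 0)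
    refine ⟨atInfinity (t • L.m) ht0, .inr ((atInfinity_eq_iff _ _).2 ⟨t, rfl⟩),
      .inr ⟨v, t • L.m, hv, ht0, hpos, rfl, rfl, ht⟩⟩

theorem position_eq_singleton {L : PosLine} {p : ProjPlane}
    (h : ∀ A : Set (Fin 2), A.Nonempty →
      ((L.projCarrier ∩ projFace A p).Nonempty ↔ i ∈ A ∧ j ∉ A)) (hij : i ≠ j) :
    L.position p = {i} := by
  have hset : {A : Set (Fin 2) | A.Nonempty ∧ (L.projCarrier ∩ projFace A p).Nonempty} = {{i}} := by
    ext A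
    rw [Set.mem_ofPred_eq, and_congr_right (h A), Set.mem_singleton_iff, Set.ext_iff,
      forall_fin_two_of_ne hij]
    simp only [Set.mem_singleton_iff, hij.symm, iff_true, iff_false]
    exact ⟨fun hA => hA.2, fun hA => ⟨⟨i, hA.1⟩, hA⟩⟩
  rw [position, hset, Set.sUnion_singleton]

theorem position_proper_of_right (hij : i ≠ j) {L : PosLine} (hm : L.m j = 1) {u : Plane}
    (hu : L.m i * u j + L.offset i j < u i) : L.position (proper u) = {i} := by
  refine position_eq_singleton (fun A hA => ?_) hij
  rw [inter_projFace_proper_nonempty, carrier_eq_obliqueLine hij hm]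
  exact obliqueLine_inter_openFace_nonempty_of_right hij (L.m_pos i) hu hA

theorem position_proper_of_left (hij : i ≠ j) {L : PosLine} (hm : L.m j = 1) {u : Plane}
    (hu : u i < L.m i * u j + L.offset i j) : L.position (proper u) = {j} := by
  refine position_eq_singleton (fun A hA => ?_) hij.symm
  rw [inter_projFace_proper_nonempty, carrier_eq_obliqueLine hij hm]
  exact obliqueLine_inter_openFace_nonempty_of_left hij (L.m_pos i) hu hA

theorem position_slopePoint_of_lt (hij : i ≠ j) {L : PosLine} (hm : L.m j = 1) {ν : ℝ}
    (hν : L.m i < ν) : L.position (slopePoint hij ν) = {i} := by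
  refine position_eq_singleton (fun A hA => ?_) hij
  have hpos : ∀ k, 0 < Function.update (1 : Plane) i ν k := by
    simp [forall_fin_two_of_ne hij, hij.symm, (L.m_pos i).trans hν]
  rw [slopePoint, inter_projFace_atInfinity_nonempty L A _ hpos, range_smul_eq_obliqueLine hij hm]
  exact obliqueLine_inter_openFace_nonempty_of_right hij (L.m_pos i) (by simpa [hij.symm]) hA

theorem position_eq_empty (L : PosLine) (hij : i ≠ j) {p : ProjPlane} (hp : ∀ u, p ≠ proper u)
    (hp' : ∀ ν, 0 < ν → p ≠ slopePoint hij ν) : L.position p = ∅ := by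
  refine Set.sUnion_eq_empty.2 ?_
  rintro A ⟨-, q, -, ⟨u, x, hu, -⟩ | ⟨v, x, hv, -, hpos, hpv, -⟩⟩
  · exact absurd hu (hp u)
  · exact absurd (hpv.trans (atInfinity_eq_slopePoint hij hv (hpos j).ne'))
      (hp' _ (div_pos (hpos i) (hpos j)))

theorem proper_mem_projCarrier (hij : i ≠ j) {L : PosLine} (hm : L.m j = 1) {x : Plane}
    (hx : x i = L.m i * x j + L.offset i j) : proper x ∈ L.projCarrier :=
  .inl (Set.mem_image_of_mem _ (carrier_eq_obliqueLine hij hm ▸ hx))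

theorem slopePoint_mem_projCarrier (hij : i ≠ j) {L : PosLine} (hm : L.m j = 1) :
    slopePoint hij (L.m i) ∈ L.projCarrier := by
  refine .inr ?_
  rw [Set.mem_singleton_iff, atInfinity_eq_slopePoint hij _ (L.m_pos j).ne', hm, div_one]

theorem m_eq_one_of_lt (hij : i ≠ j) {L : PosLine} (h : L.m i < 1) : L.m j = 1 := by
  have hmax := L.m_max
  rw [apply_zero_one_eq (f := fun k l => max (L.m k) (L.m l)) (fun _ _ => max_comm _ _) hij] at hmax
  exact (max_eq_iff.1 hmax).elim (fun h' => absurd h'.1 h.ne) fun h' => h'.1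

theorem exists_slope_offset_eq (hij : i ≠ j) {μ : ℝ} (hμ : 0 < μ) (hμ1 : μ ≤ 1) (c : ℝ) :
    ∃ L : PosLine, L.m j = 1 ∧ L.m i = μ ∧ L.offset i j = c := by
  let m : Plane := Function.update 1 i μ
  let b : Plane := Function.update (fun _ => -(c / (1 + μ))) i (c / (1 + μ))
  have hmi : m i = μ := Function.update_self ..
  have hmj : m j = 1 := Function.update_of_ne hij.symm ..
  have hbi : b i = c / (1 + μ) := Function.update_self ..
  have hbj : b j = -(c / (1 + μ)) := Function.update_of_ne hij.symm ..
  have hmax : max (m 0) (m 1) = 1 := by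
    rw [apply_zero_one_eq (f := fun k l => max (m k) (m l)) (fun _ _ => max_comm _ _) hij, hmi, hmj,
      max_eq_right hμ1]
  have hsum : b 0 + b 1 = 0 := by
    rw [apply_zero_one_eq (f := fun k l => b k + b l) (fun _ _ => add_comm _ _) hij, hbi, hbj,
      add_neg_cancel]
  have hpos : ∀ k, 0 < m k := (forall_fin_two_of_ne hij).2 ⟨hmi ▸ hμ, hmj ▸ one_pos⟩
  refine ⟨⟨m, b, hpos, hmax, hsum⟩, hmj, hmi, ?_⟩
  simp only [offset, hmi, hbi, hbj]
  field_simp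
  ring

end PosLine

/-- The weighted parameter, up to a constant, of the push onto the line `x i = μ * x j + c`. Unlike
the parameter itself, it makes sense for the axis-parallel lines, where `μ = 0`. -/
def lineFn (i j : Fin 2) (μ c : ℝ) (u : Plane) : ℝ := max (u i) (μ * u j + c)

theorem PosLine.isWeightedParam_lineFn (hij : i ≠ j) {L : PosLine} (hm : L.m j = 1) :
    L.IsWeightedParam (lineFn i j (L.m i) (L.offset i j)) := by
  refine ⟨L.b i, fun u => ?_⟩
  have hmi := L.m_pos i
  have hmax : max (L.m i) (L.m j) = 1 := (apply_zero_one_eq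
    (f := fun k l => max (L.m k) (L.m l)) (fun _ _ => max_comm _ _) hij).symm.trans L.m_max
  have hw : L.weight = L.m i := (apply_zero_one_eq (f := fun k l => min (L.m k) (L.m l))
    (fun _ _ => min_comm _ _) hij).trans (min_eq_left (hm ▸ hmax ▸ le_max_left _ _))
  have hp : L.pushParam u = max ((u i - L.b i) / L.m i) ((u j - L.b j) / L.m j) :=
    apply_zero_one_eq (f := fun k l => max ((u k - L.b k) / L.m k) ((u l - L.b l) / L.m l))
      (fun _ _ => max_comm _ _) hij
  rw [hw, hp, mul_max_of_nonneg _ _ hmi.le, ← max_add_add_right, lineFn, PosLine.offset, hm]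
  congr 1
  · field_simp
    ring
  · ring

theorem supMap_lineFn (i j : Fin 2) {μ : ℝ} (hμ : 0 ≤ μ) (c : ℝ) : SupMap (lineFn i j μ c) := by
  intro p q
  simp only [lineFn, Pi.sup_apply]
  rw [mul_max_of_nonneg _ _ hμ, ← max_add_add_right]
  exact max_max_max_comm _ _ _ _

theorem continuous_lineFn (i j : Fin 2) (u : Plane) :
    Continuous fun x : ℝ × ℝ => lineFn i j x.1 x.2 u := by
  unfold lineFn
  fun_prop

end Projective

/-! ## Cells of steep lines -/

section Cells

variable {i j : Fin 2} {a μ c μ₀ c₀ : ℝ} {W : Set Plane} {V : Set ℝ}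

/-- The line `x i = μ * x j + c` is steeper than the slopes in `V`, and it leaves the points of `W`
strictly on the same side as the line `x i = a` moved slightly to the left. -/
structure InOpenCell (W : Set Plane) (V : Set ℝ) (i j : Fin 2) (a μ c : ℝ) : Prop where
  pos : 0 < μ
  slope_lt : ∀ ν ∈ V, μ < ν
  left : ∀ w ∈ W, w i < a → w i < μ * w j + c
  right : ∀ w ∈ W, a ≤ w i → μ * w j + c < w i

/-- The weak inequalities of `InOpenCell`. They also hold for the line `x i = a` itself. -/
structure InClosedCell (W : Set Plane) (V : Set ℝ) (i j : Fin 2) (a μ c : ℝ) : Prop where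
  nonneg : 0 ≤ μ
  slope_le : ∀ ν ∈ V, μ ≤ ν
  left : ∀ w ∈ W, w i < a → w i ≤ μ * w j + c
  right : ∀ w ∈ W, a ≤ w i → μ * w j + c ≤ w i

theorem InClosedCell.combine (h : InClosedCell W V i j a μ c) (h₀ : InOpenCell W V i j a μ₀ c₀)
    {t : ℝ} (ht : 0 < t) (ht1 : t ≤ 1) :
    InOpenCell W V i j a ((1 - t) * μ + t * μ₀) ((1 - t) * c + t * c₀) := by
  have key : ∀ {x y x₀ y₀ : ℝ}, x ≤ y → x₀ < y₀ → (1 - t) * x + t * x₀ < (1 - t) * y + t * y₀ :=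
    fun hxy hxy₀ => add_lt_add_of_le_of_lt (mul_le_mul_of_nonneg_left hxy (sub_nonneg.2 ht1))
      (mul_lt_mul_of_pos_left hxy₀ ht)
  refine ⟨?_, fun ν hν => ?_, fun w hw hwa => ?_, fun w hw hwa => ?_⟩
  · linarith [key h.nonneg h₀.pos]
  · linarith [key (h.slope_le ν hν) (h₀.slope_lt ν hν)]
  · linarith [key (h.left w hw hwa) (h₀.left w hw hwa)]
  · linarith [key (h.right w hw hwa) (h₀.right w hw hwa)]

theorem exists_inOpenCell (hW : W.Finite) (hV : V.Finite) (hV0 : ∀ ν ∈ V, 0 < ν) :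
    ∃ μ c, InOpenCell W V i j a μ c := by
  have hlim : ∀ f : ℝ → ℝ, Continuous f → Tendsto f (𝓝[>] 0) (𝓝 (f 0)) :=
    fun f hf => (hf.tendsto 0).mono_left nhdsWithin_le_nhds
  have hslope : ∀ᶠ t in 𝓝[>] (0 : ℝ), ∀ ν ∈ V, t ^ 2 < ν :=
    (eventually_all_finite hV).2 fun ν hν =>
      (hlim (· ^ 2) (by fun_prop)).eventually_lt_const (by simpa using hV0 ν hν)
  have hleft : ∀ᶠ t in 𝓝[>] (0 : ℝ), ∀ w ∈ W, w i < a → w i < t ^ 2 * w j + (a - t) :=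
    (eventually_all_finite hW).2 fun w _ => eventually_imp_distrib_left.2 fun hwa =>
      (hlim (fun t => t ^ 2 * w j + (a - t)) (by fun_prop)).eventually_const_lt (by simpa)
  have hright : ∀ᶠ t in 𝓝[>] (0 : ℝ), ∀ w ∈ W, t * w j < 1 :=
    (eventually_all_finite hW).2 fun w _ =>
      (hlim (· * w j) (by fun_prop)).eventually_lt_const (by simp)
  obtain ⟨t, ht0 : 0 < t, hs, hl, hr⟩ :=
    (eventually_mem_nhdsWithin.and (hslope.and (hleft.and hright))).exists
  refine ⟨t ^ 2, a - t, by positivity, hs, hl, fun w hw hwa => ?_⟩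
  nlinarith [hr w hw]

theorem inClosedCell_axis (hV : ∀ ν ∈ V, 0 < ν) : InClosedCell W V i j a 0 a where
  nonneg := le_rfl
  slope_le ν hν := (hV ν hν).le
  left w _ hw := by linarith
  right w _ hw := by linarith

theorem exists_inClosedCell_axis (hW : W.Finite) (hV : ∀ ν ∈ V, 0 < ν) {v : Plane} (hv : v ∈ W)
    (hva : v i < a) : ∃ w ∈ W, w i < a ∧ v i ≤ w i ∧ InClosedCell W V i j a 0 (w i) := by
  obtain ⟨w, ⟨hw, hwa⟩, hmax⟩ := Set.exists_max_image {w ∈ W | w i < a} (fun w => w i)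
    (hW.subset fun w hw => hw.1) ⟨v, hv, hva⟩
  refine ⟨w, hw, hwa, hmax v ⟨hv, hva⟩, le_rfl, fun ν hν => (hV ν hν).le, fun x hx hxa => ?_,
    fun x _ hxa => ?_⟩
  · linarith [hmax x ⟨hx, hxa⟩]
  · linarith

/-- Some line `x i = μ * x j + c` weakly separates the points of `W` left of the line `x i = a`
from the others; see `IsSeparatingSlope.exists_offset`. -/
def IsSeparatingSlope (W : Set Plane) (i j : Fin 2) (a μ : ℝ) : Prop :=
  ∀ w ∈ W, w i < a → ∀ w' ∈ W, a ≤ w' i → w i - μ * w j ≤ w' i - μ * w' j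

theorem IsSeparatingSlope.exists_offset (hW : W.Finite) (hne : W.Nonempty)
    (h : IsSeparatingSlope W i j a μ) :
    ∃ c, (∀ w ∈ W, w i < a → w i ≤ μ * w j + c) ∧ (∀ w ∈ W, a ≤ w i → μ * w j + c ≤ w i) ∧
      ∃ w ∈ W, w i = μ * w j + c := by
  by_cases hR : ∃ w ∈ W, a ≤ w i
  · obtain ⟨r, ⟨hr, hra⟩, hmin⟩ := Set.exists_min_image {w ∈ W | a ≤ w i}
      (fun w => w i - μ * w j) (hW.subset fun w hw => hw.1) hR
    refine ⟨r i - μ * r j, fun w hw hwa => ?_, fun w hw hwa => ?_, r, hr, by ring⟩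
    · linarith [h w hw hwa r hr hra]
    · linarith [hmin w ⟨hw, hwa⟩]
  · push Not at hR
    obtain ⟨l, hl, hmax⟩ := Set.exists_max_image W (fun w => w i - μ * w j) hW hne
    refine ⟨l i - μ * l j, fun w hw _ => ?_, fun w hw hwa => absurd hwa (hR w hw).not_ge, l, hl,
      by ring⟩
    linarith [hmax w hw]

theorem exists_critical_slope (hW : W.Finite) (hV : V.Finite) (hV0 : ∀ ν ∈ V, 0 < ν)
    (hne : V.Nonempty) :
    ∃ μ, 0 < μ ∧ (∀ ν ∈ V, μ ≤ ν) ∧ IsSeparatingSlope W i j a μ ∧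
      (μ ∈ V ∨ ∃ w ∈ W, ∃ w' ∈ W, w i < a ∧ a ≤ w' i ∧ w i - μ * w j = w' i - μ * w' j) := by
  let P : Set (Plane × Plane) := {p ∈ W ×ˢ W | p.1 i < a ∧ a ≤ p.2 i ∧ p.1 j < p.2 j}
  let crossing : Plane × Plane → ℝ := fun p => (p.2 i - p.1 i) / (p.2 j - p.1 j)
  have hP : P.Finite := (hW.prod hW).subset fun p hp => hp.1
  obtain ⟨μ, hμ, hmin⟩ := Set.exists_min_image (V ∪ crossing '' P) id
    (hV.union (hP.image crossing)) (hne.mono Set.subset_union_left)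
  have hpos : 0 < μ := by
    obtain hμ | ⟨p, ⟨-, hl, hr, hlt⟩, rfl⟩ := hμ
    · exact hV0 μ hμ
    · exact div_pos (by linarith) (by linarith)
  refine ⟨μ, hpos, fun ν hν => hmin ν (.inl hν), fun w hw hwa w' hw' hwa' => ?_, ?_⟩
  · by_cases hlt : w j < w' j
    · have := hmin _ (.inr ⟨(w, w'), ⟨⟨hw, hw'⟩, hwa, hwa', hlt⟩, rfl⟩)
      rw [id, id, le_div_iff₀ (sub_pos.2 hlt)] at this
      linarith
    · linarith [mul_le_mul_of_nonneg_left (not_lt.1 hlt) hpos.le]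
  · obtain hμ | ⟨⟨w, w'⟩, ⟨⟨hw, hw'⟩, hl, hr, hlt⟩, rfl⟩ := hμ
    · exact .inl hμ
    · refine .inr ⟨w, hw, w', hw', hl, hr, ?_⟩
      have := sub_pos.2 hlt
      simp only [crossing]
      field_simp
      ring

/-- The line is reached by turning `x i = a` as far as its closed cell permits. -/
theorem exists_critical_line (hW : W.Finite) (hWne : W.Nonempty) (hV : V.Finite)
    (hV0 : ∀ ν ∈ V, 0 < ν) (hVne : V.Nonempty) :
    ∃ μ c, 0 < μ ∧ InClosedCell W V i j a μ c ∧ ∃ w ∈ W, w i = μ * w j + c ∧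
      (μ ∈ V ∨ ∃ w' ∈ W, w' ≠ w ∧ w' i = μ * w' j + c) := by
  obtain ⟨μ, hμ, hμV, hsep, hcrit⟩ :=
    exists_critical_slope (i := i) (j := j) (a := a) hW hV hV0 hVne
  obtain ⟨c, hl, hr, w₀, hw₀, hw₀c⟩ := hsep.exists_offset hW hWne
  refine ⟨μ, c, hμ, ⟨hμ.le, hμV, hl, hr⟩, ?_⟩
  obtain hμ | ⟨w, hw, w', hw', hwa, hwa', heq⟩ := hcrit
  · exact ⟨w₀, hw₀, hw₀c, .inl hμ⟩
  · have := hl w hw hwa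
    have := hr w' hw' hwa'
    exact ⟨w, hw, by linarith, .inr ⟨w', hw', by rintro rfl; linarith, by linarith⟩⟩

theorem InClosedCell.lineFn_eq (h : InClosedCell W V i j a μ c) {u : Plane} (hu : u ∈ W)
    (hua : a ≤ u i) : lineFn i j μ c u = u i :=
  max_eq_left (h.right u hu hua)

theorem lineFn_zero (i j : Fin 2) (c : ℝ) (u : Plane) : lineFn i j 0 c u = max (u i) c := by
  rw [lineFn, zero_mul, zero_add]

/-- If exactly one of the points lies left of `x i = a`, then moving this line to the left does not
decrease the difference. -/
theorem abs_lineFn_sub_le (hW : W.Finite) (hV : ∀ ν ∈ V, 0 < ν) (h : InClosedCell W V i j a μ c)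
    {u v : Plane} (hu : u ∈ W) (hv : v ∈ W) :
    |lineFn i j 0 a u - lineFn i j 0 a v| ≤ |lineFn i j μ c u - lineFn i j μ c v| ∨
      ∃ w ∈ W, w i < a ∧ InClosedCell W V i j a 0 (w i) ∧
        |lineFn i j 0 a u - lineFn i j 0 a v| ≤
          |lineFn i j 0 (w i) u - lineFn i j 0 (w i) v| := by
  wlog huv : v i ≤ u i generalizing u v
  · simpa only [abs_sub_comm] using this hv hu (not_le.1 huv).le
  obtain hva | hva := le_or_gt a (v i)
  · left
    have hua := hva.trans huv
    rw [h.lineFn_eq hu hua, h.lineFn_eq hv hva, lineFn_zero, lineFn_zero, max_eq_left hua,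
      max_eq_left hva]
  obtain hua | hua := le_or_gt a (u i)
  · right
    obtain ⟨w, hw, hwa, hvw, hcell⟩ := exists_inClosedCell_axis (j := j) hW hV hv hva
    refine ⟨w, hw, hwa, hcell, ?_⟩
    rw [hcell.lineFn_eq hu hua, lineFn_zero, lineFn_zero, lineFn_zero, max_eq_left hua,
      max_eq_right hva.le, max_eq_right hvw, abs_of_nonneg (by linarith),
      abs_of_nonneg (by linarith)]
    linarith
  · left
    rw [lineFn_zero, lineFn_zero, max_eq_right hua.le, max_eq_right hva.le, sub_self, abs_zero]
    exact abs_nonneg _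

theorem termValue_lineFn_le (hW : W.Finite) (hV : ∀ ν ∈ V, 0 < ν) (h : InClosedCell W V i j a μ c)
    {y : CostTerm Plane} (hy : y ∈ costTerms W) :
    termValue (lineFn i j 0 a) y ≤ termValue (lineFn i j μ c) y ∨
      ∃ w ∈ W, w i < a ∧ InClosedCell W V i j a 0 (w i) ∧
        termValue (lineFn i j 0 a) y ≤ termValue (lineFn i j 0 (w i)) y := by
  obtain ⟨u, v, k⟩ := y
  obtain ⟨rfl | ⟨u, hu, rfl⟩, rfl | ⟨v, hv, rfl⟩, hk⟩ := hy
  · exact .inl (by simp only [termValue_top_top, le_refl])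
  · exact .inl (by simp only [termValue_top_coe, le_refl])
  · exact .inl (by simp only [termValue_coe_top, le_refl])
  · have hmono : ∀ {x y : ℝ}, x ≤ y → ENNReal.ofReal (x / k) ≤ ENNReal.ofReal (y / k) :=
      fun hxy => ENNReal.ofReal_le_ofReal (div_le_div_of_nonneg_right hxy k.cast_nonneg)
    simp only [termValue_coe_coe _ _ _ (pos_of_mem_one_two hk)]
    exact (abs_lineFn_sub_le hW hV h hu hv).imp hmono
      fun ⟨w, hw, hwa, hcell, hle⟩ => ⟨w, hw, hwa, hcell, hmono hle⟩

end Cells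

section Slopes

variable {i j : Fin 2} {hij : i ≠ j} {a : ℝ} {U : Set ProjPlane}

/-- The slopes `ν` for which the point at infinity of the lines `x i = ν * x j + c` lies in `U`. -/
def slopes (hij : i ≠ j) (U : Set ProjPlane) : Set ℝ := {ν | 0 < ν ∧ slopePoint hij ν ∈ U}

theorem pos_of_mem_slopes : ∀ ν ∈ slopes hij U, 0 < ν := fun _ h => h.1

theorem slopes_finite (hij : i ≠ j) (hU : U.Finite) : (slopes hij U).Finite :=
  (hU.preimage (slopePoint_injective hij).injOn).subset fun _ h => h.2

theorem one_mem_slopes (h : diagonalPoint ∈ U) : 1 ∈ slopes hij U :=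
  ⟨one_pos, (slopePoint_one hij).symm ▸ h⟩

theorem equivalent_of_inOpenCell {L L' : PosLine} (hm : L.m j = 1) (hm' : L'.m j = 1)
    (h : InOpenCell (proper ⁻¹' U) (slopes hij U) i j a (L.m i) (L.offset i j))
    (h' : InOpenCell (proper ⁻¹' U) (slopes hij U) i j a (L'.m i) (L'.offset i j)) :
    PosLine.Equivalent U L L' := by
  intro p hp
  by_cases hu : ∃ u, p = proper u
  · obtain ⟨u, rfl⟩ := hu
    obtain hua | hua := lt_or_ge (u i) a
    · rw [L.position_proper_of_left hij hm (h.left u hp hua),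
        L'.position_proper_of_left hij hm' (h'.left u hp hua)]
    · rw [L.position_proper_of_right hij hm (h.right u hp hua),
        L'.position_proper_of_right hij hm' (h'.right u hp hua)]
  by_cases hν : ∃ ν, 0 < ν ∧ p = slopePoint hij ν
  · obtain ⟨ν, hν, rfl⟩ := hν
    rw [L.position_slopePoint_of_lt hij hm (h.slope_lt ν ⟨hν, hp⟩),
      L'.position_slopePoint_of_lt hij hm' (h'.slope_lt ν ⟨hν, hp⟩)]
  · push Not at hu hν
    rw [L.position_eq_empty hij hu hν, L'.position_eq_empty hij hu hν]

/-- The line passes through a proper point of `U` and through a second point of `U`, which may lie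
at infinity. -/
def PosLine.IsSpecial (U : Set ProjPlane) (L : PosLine) : Prop :=
  ∃ u, proper u ∈ U ∧ proper u ∈ L.projCarrier ∧ ∃ q ∈ U, q ≠ proper u ∧ q ∈ L.projCarrier

theorem exists_isSpecial_inClosedCell (hij : i ≠ j) (hU : U.Finite)
    (hne : (proper ⁻¹' U).Nonempty) (hdiag : diagonalPoint ∈ U) (a : ℝ) :
    ∃ L : PosLine, L.m j = 1 ∧ L.IsSpecial U ∧
      InClosedCell (proper ⁻¹' U) (slopes hij U) i j a (L.m i) (L.offset i j) := by
  have h1 : 1 ∈ slopes hij U := one_mem_slopes hdiag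
  obtain ⟨μ, c, hμ, hcell, w, hw, hwc, hcrit⟩ := exists_critical_line (i := i) (j := j) (a := a)
    (hU.preimage proper_injective.injOn) hne (slopes_finite hij hU) pos_of_mem_slopes ⟨1, h1⟩
  obtain ⟨L, hm, rfl, rfl⟩ := PosLine.exists_slope_offset_eq hij hμ (hcell.slope_le 1 h1) c
  refine ⟨L, hm, ⟨w, hw, L.proper_mem_projCarrier hij hm hwc, ?_⟩, hcell⟩
  obtain hμ | ⟨w', hw', hne, hwc'⟩ := hcrit
  · exact ⟨_, hμ.2, (proper_ne_atInfinity _ _ _).symm, L.slopePoint_mem_projCarrier hij hm⟩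
  · exact ⟨_, hw', proper_injective.ne hne, L.proper_mem_projCarrier hij hm hwc'⟩

end Slopes

/-! ## The cost of axis-parallel lines -/

theorem PropertyP.supClosure_nonempty {F : Type u} [Field F] {M : PersistenceModule.{u, w} F Plane}
    {C : Set Plane} (hC : PropertyP M C) (hM : M.PointwiseFinite) (h : ¬ M.IsTrivial) :
    (supClosure C).Nonempty := by
  by_contra hne
  rw [Set.not_nonempty_iff_eq_empty] at hne
  exact h fun p => hM.subsingleton ((hC.2 p p le_rfl).2 (by simp [hne]))

section Cell

variable {i j : Fin 2} {hij : i ≠ j} {a μ c : ℝ} {CM CN : Set Plane} {Ω U : Set ProjPlane}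
  {L₀ : PosLine}

theorem compat_of_inOpenCell (hΩ : PropertyQ (supClosure CM ∪ supClosure CN) Ω)
    (hU : proper '' (supClosure CM ∪ supClosure CN) ∪ Ω ⊆ U) (hdiag : diagonalPoint ∈ U)
    (hm₀ : L₀.m j = 1)
    (h₀ : InOpenCell (proper ⁻¹' U) (slopes hij U) i j a (L₀.m i) (L₀.offset i j))
    (h : InOpenCell (proper ⁻¹' U) (slopes hij U) i j a μ c) :
    Compat CM CN L₀.pushParam (lineFn i j μ c) := by
  obtain ⟨L, hm, rfl, rfl⟩ :=
    PosLine.exists_slope_offset_eq hij h.pos (h.slope_lt 1 (one_mem_slopes hdiag)).le c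
  have hequiv : PosLine.Equivalent (proper '' (supClosure CM ∪ supClosure CN) ∪ Ω) L₀ L :=
    fun p hp => equivalent_of_inOpenCell hm₀ hm h₀ h p (hU hp)
  exact (compat_of_equivalent hΩ hequiv).weighted (L.isWeightedParam_lineFn hij hm)

theorem compat_of_inClosedCell (hΩ : PropertyQ (supClosure CM ∪ supClosure CN) Ω)
    (hU : proper '' (supClosure CM ∪ supClosure CN) ∪ Ω ⊆ U) (hdiag : diagonalPoint ∈ U)
    (hm₀ : L₀.m j = 1)
    (h₀ : InOpenCell (proper ⁻¹' U) (slopes hij U) i j a (L₀.m i) (L₀.offset i j))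
    (h : InClosedCell (proper ⁻¹' U) (slopes hij U) i j a μ c) :
    Compat CM CN L₀.pushParam (lineFn i j μ c) := by
  let γ : ℝ → ℝ × ℝ := fun t => ((1 - t) * μ + t * L₀.m i, (1 - t) * c + t * L₀.offset i j)
  have hγ : Tendsto γ (𝓝[>] 0) (𝓝 (μ, c)) := by
    have : Continuous γ := by fun_prop
    simpa [γ] using (this.tendsto 0).mono_left nhdsWithin_le_nhds
  refine Compat.of_tendsto (l := 𝓝[>] 0) (G := fun t => lineFn i j (γ t).1 (γ t).2) ?_
    fun u => ((continuous_lineFn i j u).tendsto (μ, c)).comp hγ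
  filter_upwards [Ioc_mem_nhdsGT one_pos] with t ht
  exact compat_of_inOpenCell hΩ hU hdiag hm₀ h₀ (h.combine h₀ ht.1 ht.2)

end Cell

section AxisCost

variable {F : Type u} [Field F] {M : PersistenceModule.{u, w₁} F Plane}
  {N : PersistenceModule.{u, w₂} F Plane} {CM CN : Set Plane} {Ω U : Set ProjPlane} {i j : Fin 2}
  (hM : M.PointwiseFinite) (hN : N.PointwiseFinite) (hCM : PropertyP M CM) (hCN : PropertyP N CN)
include hM hN hCM hCN

theorem exists_term_costAt_inClosedCell (hij : i ≠ j)
    (hΩ : PropertyQ (supClosure CM ∪ supClosure CN) Ω)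
    (hU : proper '' (supClosure CM ∪ supClosure CN) ∪ Ω ⊆ U) (hUfin : U.Finite)
    (hdiag : diagonalPoint ∈ U) (a : ℝ) :
    ∃ y ∈ costTerms (proper ⁻¹' U), ∀ μ c,
      InClosedCell (proper ⁻¹' U) (slopes hij U) i j a μ c →
        CostAt M N CM CN (lineFn i j μ c) (termValue (lineFn i j μ c) y) := by
  obtain ⟨μ₀, c₀, h₀⟩ := exists_inOpenCell (i := i) (j := j) (a := a)
    (hUfin.preimage proper_injective.injOn) (slopes_finite hij hUfin) pos_of_mem_slopes
  obtain ⟨L₀, hm₀, rfl, rfl⟩ :=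
    PosLine.exists_slope_offset_eq hij h₀.pos (h₀.slope_lt 1 (one_mem_slopes hdiag)).le c₀
  obtain ⟨y, hy, hcost⟩ := exists_term_costAt hM hN hCM hCN L₀
  have hKU : supClosure CM ∪ supClosure CN ⊆ proper ⁻¹' U :=
    fun u hu => hU (.inl (Set.mem_image_of_mem _ hu))
  exact ⟨y, costTerms_mono hKU hy,
    fun μ c h => hcost _ (compat_of_inClosedCell hΩ hU hdiag hm₀ h₀ h)⟩

/-- If the cost is smaller on the special line of the closed cell than on `x i = a`, then it does
not decrease when `x i = a` is moved left to the next proper point of `U`. -/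
theorem exists_isSpecial_ge (hij : i ≠ j) (hΩ : PropertyQ (supClosure CM ∪ supClosure CN) Ω)
    (hU : proper '' (supClosure CM ∪ supClosure CN) ∪ Ω ⊆ U) (hUfin : U.Finite)
    (hne : (proper ⁻¹' U).Nonempty) (hdiag : diagonalPoint ∈ U) (a : ℝ) :
    ∃ κ, CostAt M N CM CN (lineFn i j 0 a) κ ∧
      ∃ L : PosLine, L.IsSpecial U ∧ κ ≤ weightedDist M N L := by
  have hW : (proper ⁻¹' U).Finite := hUfin.preimage proper_injective.injOn
  have hV : ∀ ν ∈ slopes hij U, 0 < ν := pos_of_mem_slopes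
  induction hn : {w ∈ proper ⁻¹' U | w i < a}.ncard using Nat.strong_induction_on
    generalizing a with
  | _ n ih =>
  subst hn
  obtain ⟨y, hy, hcost⟩ := exists_term_costAt_inClosedCell hM hN hCM hCN hij hΩ hU hUfin hdiag a
  refine ⟨_, hcost 0 a (inClosedCell_axis hV), ?_⟩
  obtain ⟨L, hm, hL, hcell⟩ := exists_isSpecial_inClosedCell hij hUfin hne hdiag a
  obtain hle | ⟨w, hw, hwa, hcellw, hle⟩ := termValue_lineFn_le hW hV hcell hy
  · have hgL := L.isWeightedParam_lineFn hij hm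
    exact ⟨L, hL, hle.trans_eq ((hcost _ _ hcell).unique hCM.1 hCN.1 hgL.supMap
      (costAt_weightedDist hM hN hCM hCN hgL))⟩
  · have hlt : {x ∈ proper ⁻¹' U | x i < w i}.ncard < {x ∈ proper ⁻¹' U | x i < a}.ncard :=
      Set.ncard_lt_ncard ⟨fun x hx => ⟨hx.1, hx.2.trans hwa⟩, fun h => (h ⟨hw, hwa⟩).2.false⟩
        (hW.subset fun x hx => hx.1)
    obtain ⟨κ, hκ, L', hL', hκL'⟩ := ih _ hlt (w i) rfl
    refine ⟨L', hL', hle.trans (Eq.trans_le ?_ hκL')⟩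
    exact (hcost 0 (w i) hcellw).unique hCM.1 hCN.1 (supMap_lineFn i j le_rfl _) hκ

theorem isAxisCost_of_costAt (hij : i ≠ j) {a : ℝ} {κ : ℝ≥0∞}
    (hκ : CostAt M N CM CN (lineFn i j 0 a) κ) : IsAxisCost M N i a κ := by
  intro r hr
  set l : Filter PosLine := comap (fun L => L.m i) (𝓝[>] 0) ⊓ 𝓟 {L | r ∈ L.carrier}
  have hm : Tendsto (fun L : PosLine => L.m i) l (𝓝 0) :=
    (tendsto_comap.mono_left inf_le_left).mono_right nhdsWithin_le_nhds
  have hlim : Tendsto (fun L : PosLine => (L.m i, r i - L.m i * r j)) l (𝓝 (0, a)) := by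
    simpa [hr] using hm.prodMk_nhds (tendsto_const_nhds.sub (hm.mul_const (r j)))
  have hrl : ∀ᶠ L in l, r ∈ L.carrier := mem_inf_of_right (mem_principal_self _)
  refine tendsto_weightedDist hM hN hCM hCN
    (G := fun L => lineFn i j (L.m i) (r i - L.m i * r j)) (supMap_lineFn i j le_rfl a) ?_
    (fun u => ((continuous_lineFn i j u).tendsto (0, a)).comp hlim) hκ
  filter_upwards [hm.eventually_lt_const one_pos, hrl] with L hL hrL
  have hmj := L.m_eq_one_of_lt hij hL
  rw [L.carrier_eq_obliqueLine hij hmj] at hrL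
  rw [show r i - L.m i * r j = L.offset i j from sub_eq_iff_eq_add'.2 hrL]
  exact L.isWeightedParam_lineFn hij hmj

end AxisCost

end MatchingDistance

open MatchingDistance in
theorem corollary3p10 {F : Type u} [Field F]
    (M : PersistenceModule.{u, w₁} F Plane) (N : PersistenceModule.{u, w₂} F Plane)
    (hM : M.PointwiseFinite) (hN : N.PointwiseFinite)
    (hMN : ¬ (M.IsTrivial ∧ N.IsTrivial))
    (CM CN : Set Plane) (hCM : PropertyP M CM) (hCN : PropertyP N CN)
    (Ω : Set ProjPlane) (hΩ : PropertyQ (supClosure CM ∪ supClosure CN) Ω)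
    -- `i = 0`: vertical lines, `i = 1`: horizontal lines
    (i : Fin 2) (a : ℝ) :
    ∃ κ : ENNReal, IsAxisCost M N i a κ ∧
      ∃ (L : PosLine) (p q : ProjPlane),
        p ∈ proper '' (supClosure CM ∪ supClosure CN) ∪ (Ω ∩ Set.range proper) ∧
        q ∈ proper '' (supClosure CM ∪ supClosure CN) ∪ (Ω ∪ {diagonalPoint}) ∧
        p ≠ q ∧ p ∈ L.projCarrier ∧ q ∈ L.projCarrier ∧
        κ ≤ weightedDist M N L := by
  obtain ⟨j, hji⟩ := exists_ne i
  have hne : (supClosure CM ∪ supClosure CN).Nonempty :=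
    Set.union_nonempty.2 ((not_and_or.1 hMN).imp (hCM.supClosure_nonempty hM)
      (hCN.supClosure_nonempty hN))
  have hfin : (proper '' (supClosure CM ∪ supClosure CN) ∪ (Ω ∪ {diagonalPoint})).Finite :=
    ((hCM.1.supClosure.union hCN.1.supClosure).image proper).union
      (hΩ.1.union (Set.finite_singleton _))
  obtain ⟨κ, hκ, L, ⟨u, hu, huL, q, hq, hqu, hqL⟩, hκL⟩ := exists_isSpecial_ge hM hN hCM hCN
    hji.symm hΩ (Set.union_subset_union_right _ Set.subset_union_left) hfin
    (hne.mono fun u hu => .inl (Set.mem_image_of_mem _ hu)) (.inr (.inr rfl)) a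
  have hu' : proper u ∈ proper '' (supClosure CM ∪ supClosure CN) ∪ (Ω ∩ Set.range proper) :=
    hu.imp_right (Or.rec (fun h => ⟨h, u, rfl⟩) fun h => absurd h (proper_ne_atInfinity _ _ _))
  exact ⟨κ, isAxisCost_of_costAt hM hN hCM hCN hji.symm hκ, L, _, q, hu', hq, hqu.symm, huL, hqL,
    hκL⟩
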